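/- **Theorem 6 (computable Tychonoff theorem).** Let $\Sigma$ be a finite alphabet containing two distinct symbols $0,1$, let $\Sigma^*$ be the set of finite words and $\Sigma^\omega$ the set of infinite sequences over $\Sigma$. Put $\iota(a_1\ldots a_n)=110a_10a_2\ldots 0a_n011$ and write $u\ll p$ if $\iota(u)$ is a subword of the word or sequence $p$; say that $p\in\Sigma^\omega$ *enumerates* $A\subseteq\Sigma^*$ if $A=\{u\mid u\ll p\}$. Use the tuplings $\langle u_1,\ldots,u_n\rangle=\iota(u_1)\ldots\iota(u_n)$ of words, $\langle p_1,\ldots,p_n\rangle=p_1(0)\ldots p_n(0)p_1(1)\ldots p_n(1)\ldots$ of finitely many sequences, and $\langle p_1,p_2,\ldots\rangle$ of infinitely many sequences, defined by $\langle p_1,p_2,\ldots\rangle\big(\tfrac{(i+j)(i+j+1)}2+j\big)=p_{i+1}(j)$ for $i,j\ge 0$. An *effective topological space* is $\mathbf X=(X,\tau,\beta,\nu)$ where $(X,\tau)$ is a $T_0$-space and $\nu$ is a partial surjection from $\Sigma^*$ onto a base $\beta$ of $\tau$. A sequence $\langle r,s\rangle$ is a *$\Delta$-name* of $\mathbf X$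 if $r$ enumerates the graph of the characteristic function of $\mathrm{dom}(\nu)$ (coded as the set of words $\langle u,1\rangle$ with $u\in\mathrm{dom}(\nu)$ and $\langle u,0\rangle$ with $u\notin\mathrm{dom}(\nu)$), and $s$ enumerates (the words $\langle u,v,w\rangle$ for $(u,v,w)$ in) a set $S\subseteq\mathrm{dom}(\nu)^3$ such that $\nu(u)\cap\nu(v)=\bigcup\{\nu(w)\mid (u,v,w)\in S\}$ for all $u,v\in\mathrm{dom}(\nu)$. Let $\mathcal T_c$ be the class of all pairs $(\mathbf X,K)$ with $\mathbf X$ an effective topological space and $K\subseteq X$ compact. A sequence $\langle r,s\rangle$ is a *$\kappa^\Delta$-name* of $(\mathbf X,K)$ if $r$ is a $\Delta$-name of $\mathbf X$ and $s$ enumerates the set of all words $w$ such that $v\in\mathrm{dom}(\nu)$ for all $v\ll w$ and $K\subseteq\bigcup\{\nu(v)\mid v\ll w\}$. Products of effective topological spaces: $\mathbf X_1\times\mathbf X_2$ is $X_1\times X_2$ with the product topology and the base notation $\nu\langle u_1,u_2\rangle=\nu_1(u_1)\times\nu_2(u_2)$ for $u_i\in\mathrm{dom}(\nu_i)$; $\mathbf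 X_1\times\cdots\times\mathbf X_n=(\cdots(\mathbf X_1\times\mathbf X_2)\times\cdots)\times\mathbf X_n$ (for $n=1$ it is $\mathbf X_1$); $\mathbf X_1\times\mathbf X_2\times\cdots$ is $\prod_{i\ge1}X_i$ with the product topology and the base notation $\nu\langle u_1,\ldots,u_m\rangle=\nu_1(u_1)\times\cdots\times\nu_m(u_m)\times X_{m+1}\times X_{m+2}\times\cdots$ for $m\ge1$, $u_i\in\mathrm{dom}(\nu_i)$. A function between classes with naming relations is *computable* if some partial function on $\Sigma^\omega$ computable by a Type-2 machine (one-way input, one-way output) maps every name of every argument to a name of its value. Then the following functions are computable. 1. $(\mathcal T_c)^2\to\mathcal T_c$, $\ ((\mathbf X_1,K_1),(\mathbf X_2,K_2))\mapsto(\mathbf X_1\times\mathbf X_2,\,K_1\times K_2)$, where the names of an argument are the sequences $\langle p_1,p_2\rangle$ with $p_i$ a $\kappa^\Delta$-name of $(\mathbf X_i,K_i)$, and values have their $\kappa^\Delta$-names. 2. $\biguplus_{n\ge1}(\mathcal T_c)^n\to\mathcal T_c$, $\ (n,(\mathbf X_1,K_1),\ldots,(\mathbf X_n,K_n))\mapsto(\mathbf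 X_1\times\cdots\times\mathbf X_n,\,K_1\times\cdots\times K_n)$, where the names of an argument are the sequences $1^n0\langle p_1,\ldots,p_n\rangle$ with $p_i$ a $\kappa^\Delta$-name of $(\mathbf X_i,K_i)$, and values have their $\kappa^\Delta$-names. 3. $(\mathcal T_c)^{\mathbb N}\to\mathcal T_c$, $\ ((\mathbf X_1,K_1),(\mathbf X_2,K_2),\ldots)\mapsto(\mathbf X_1\times\mathbf X_2\times\cdots,\,K_1\times K_2\times\cdots)$, where the names of an argument are the sequences $\langle p_1,p_2,\ldots\rangle$ with $p_i$ a $\kappa^\Delta$-name of $(\mathbf X_i,K_i)$, and values have their $\kappa^\Delta$-names. -/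

import Mathlib

/-! Type-2 computability on multi-represented classes, effective topological spaces,
their products, and the multi-representation of compact sets by finite base covers. -/

universe u v

namespace TTE

/-! ### Words, sequences, tupling -/

/-- A finite alphabet with two distinguished symbols `0 ≠ 1`; `k` is the number of further
symbols. -/
abbrev Sym (k : ℕ) : Type := Fin (k + 2)

/-- Finite words. -/
abbrev Word (k : ℕ) : Type := List (Sym k)

/-- Infinite sequences. -/
abbrev Seq (k : ℕ) : Type := ℕ → Sym k

variable {k : ℕ}

/-- The wrapping function `a₁a₂…aₙ ↦ 11 0a₁ 0a₂ … 0aₙ 011`. -/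
def iota (w : Word k) : Word k := [1, 1] ++ w.flatMap (fun a => [0, a]) ++ [0, 1, 1]

/-- `⟨u₁,…,uₙ⟩ = ι(u₁)…ι(uₙ)`. -/
def tuple (l : List (Word k)) : Word k := l.flatMap iota

/-- The prefix of length `n` of a sequence. -/
def pre (p : Seq k) (n : ℕ) : Word k := (List.range n).map p

/-- `u ≪ w` for words: `ι(u)` is a subword of `w`. -/
def InWord (u w : Word k) : Prop := iota u <:+: w

/-- `u ≪ p` for sequences: `ι(u)` is a subword of `p`. -/
def InSeq (u : Word k) (p : Seq k) : Prop := ∃ n, iota u <:+: pre p n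

/-- The sequence `p` is a list of exactly the words of `A`. -/
def Enumerates (p : Seq k) (A : Set (Word k)) : Prop := ∀ w, InSeq w p ↔ w ∈ A

/-- `⟨p₁,…,pₙ₊₁⟩ = p₁(0)p₂(0)…pₙ₊₁(0)p₁(1)…`. -/
def seqTuple {n : ℕ} (p : Fin (n + 1) → Seq k) : Seq k :=
  fun m => p (Fin.ofNat (n + 1) m) (m / (n + 1))

/-- `⟨p,q⟩ = p(0)q(0)p(1)q(1)…`. -/
def seqPair (p q : Seq k) : Seq k := seqTuple ![p, q]

/-- The Cantor pairing function. -/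
def cantorPair (i j : ℕ) : ℕ := (i + j) * (i + j + 1) / 2 + j

/-- `q = ⟨p₀,p₁,…⟩`, that is, `q⟨i,j⟩ = pᵢ(j)`. -/
def IsSeqTuple (q : Seq k) (p : ℕ → Seq k) : Prop := ∀ i j, q (cantorPair i j) = p i j

/-- The sequence `1ⁿ0p`. -/
def tag (n : ℕ) (p : Seq k) : Seq k :=
  fun m => if m < n then 1 else if m = n then 0 else p (m - (n + 1))

/-! ### Type-2 machines -/

/-- A Type-2 machine with an infinite one-way read-only input tape, a one-way write-only output
tape and a discrete work memory. In one step it looks at its memory and at the input symbol under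
the reading head; it updates the memory, advances the head or not, and appends at most one symbol
to the output. The transition function is computable. -/
structure Machine (k : ℕ) where
  Mem : Type
  [mem : Primcodable Mem]
  init : Mem
  step : Mem × Sym k → Mem × Bool × Option (Sym k)
  step_computable : Computable step

/-- Memory, position of the input head, output written so far. -/
structure Machine.Config (M : Machine k) where
  mem : M.Mem
  head : ℕ
  out : Word k

/-- One step on input `p`. -/
def Machine.next (M : Machine k) (p : Seq k) (c : M.Config) : M.Config :=
  let r := M.step (c.mem, p c.head)
  { mem := r.1
    head := if r.2.1 then c.head + 1 else c.head
    out := c.out ++ r.2.2.toList }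

/-- The configuration after `t` steps on input `p`. -/
def Machine.run (M : Machine k) (p : Seq k) : ℕ → M.Config
  | 0 => ⟨M.init, 0, []⟩
  | t + 1 => M.next p (M.run p t)

/-- On input `p`, working forever, the machine writes the infinite sequence `q`. -/
def Machine.Writes (M : Machine k) (p q : Seq k) : Prop :=
  ∀ n, ∃ t, pre q n <+: (M.run p t).out

/-- A partial function on sequences is computable if it is the function `f_M` of some machine `M`:
`f_M(p) = q` if `M` writes `q` on input `p`, and `f_M(p)` is undefined if the output is finite. -/
def ComputableSeqFun (g : Seq k →. Seq k) : Prop :=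
  ∃ M : Machine k, ∀ p q, q ∈ g p ↔ M.Writes p q

/-! ### Multi-representations -/

/-- A naming relation: `δ p x` means that `p` is a `δ`-name of `x`. An object may have many names,
and a name may belong to many objects. -/
def MultiRep (k : ℕ) (M : Type u) : Type u := Seq k → M → Prop

/-- `g` realizes `f` if it maps every name of `x` to a name of `f x`. -/
def Realizes {M : Type u} {M' : Type v} (γ : MultiRep k M) (γ' : MultiRep k M')
    (g : Seq k →. Seq k) (f : M → M') : Prop :=
  ∀ p x, γ p x → ∃ q ∈ g p, γ' q (f x)

/-- `f` is `(γ,γ')`-computable. -/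
def RepComputable {M : Type u} {M' : Type v} (γ : MultiRep k M) (γ' : MultiRep k M')
    (f : M → M') : Prop :=
  ∃ g : Seq k →. Seq k, ComputableSeqFun g ∧ Realizes γ γ' g f

/-- `[γ,δ]`. -/
def MultiRep.pair {M : Type u} {M' : Type v} (γ : MultiRep k M) (δ : MultiRep k M') :
    MultiRep k (M × M') :=
  fun q x => ∃ p₁ p₂, q = seqPair p₁ p₂ ∧ γ p₁ x.1 ∧ δ p₂ x.2

/-- `[δ]⁺` on the disjoint union of the powers `Mⁿ`, `n ≥ 1`: the names of an `n`-tuple are the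
sequences `1ⁿ0⟨p₁,…,pₙ⟩`. The element `⟨n, x⟩` is a tuple of length `n + 1`. -/
def MultiRep.plus {M : Type u} (δ : MultiRep k M) : MultiRep k (Σ n : ℕ, (Fin (n + 1) → M)) :=
  fun q x => ∃ p : Fin (x.1 + 1) → Seq k,
    q = tag (x.1 + 1) (seqTuple p) ∧ ∀ i, δ (p i) (x.2 i)

/-- `[δ]^ℕ`. -/
def MultiRep.seq {M : Type u} (δ : MultiRep k M) : MultiRep k (ℕ → M) :=
  fun q x => ∃ p : ℕ → Seq k, IsSeqTuple q p ∧ ∀ i, δ (p i) (x i)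

/-! ### Effective topological spaces -/

/-- An effective topological space `(X,τ,β,ν)`: a `T₀`-space with a partial map `ν` from words
onto a base `β`. The partial map is given by its domain `dom` and its values on it; outside of
`dom` the value is set to `∅`, so that `x ∈ ν w` implies `w ∈ dom`. -/
structure EffSpace (k : ℕ) where
  carrier : Type u
  [top : TopologicalSpace carrier]
  t0 : T0Space carrier
  dom : Set (Word k)
  nu : Word k → Set carrier
  nu_off : ∀ w, w ∉ dom → nu w = ∅
  isBase : TopologicalSpace.IsTopologicalBasis (nu '' dom)

instance : CoeSort (EffSpace.{u} k) (Type u) := ⟨EffSpace.carrier⟩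

instance (X : EffSpace.{u} k) : TopologicalSpace X := X.top

instance (X : EffSpace.{u} k) : T0Space X := X.t0

theorem EffSpace.mem_dom (X : EffSpace.{u} k) {w : Word k} {x : X} (h : x ∈ X.nu w) :
    w ∈ X.dom := by
  by_contra hw
  rw [X.nu_off w hw] at h
  exact h

theorem EffSpace.isOpen_nu (X : EffSpace.{u} k) (w : Word k) : IsOpen (X.nu w) := by
  by_cases hw : w ∈ X.dom
  · exact X.isBase.isOpen ⟨w, hw, rfl⟩
  · rw [X.nu_off w hw]; exact isOpen_empty

theorem EffSpace.exists_nu (X : EffSpace.{u} k) {x : X} {U : Set X} (hU : IsOpen U) (hx : x ∈ U) :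
    ∃ w ∈ X.dom, x ∈ X.nu w ∧ X.nu w ⊆ U := by
  obtain ⟨_, ⟨w, hw, rfl⟩, h⟩ := X.isBase.exists_subset_of_mem_open hx hU
  exact ⟨w, hw, h⟩

/-! ### Unique decoding of tuples of words -/

theorem iota_append_inj {u v s t : Word k} (h : iota u ++ s = iota v ++ t) : u = v ∧ s = t := by
  simp only [iota, List.append_assoc, List.cons_append, List.nil_append, List.cons.injEq,
    true_and] at h
  induction u generalizing v with
  | nil =>
    cases v with
    | nil => simpa using h
    | cons a v =>
      simp only [List.flatMap_nil, List.nil_append, List.flatMap_cons, List.cons_append,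
        List.cons.injEq, true_and] at h
      exfalso
      cases v <;> simp at h
  | cons a u ih =>
    cases v with
    | nil =>
      simp only [List.flatMap_nil, List.nil_append, List.flatMap_cons, List.cons_append,
        List.cons.injEq, true_and] at h
      exfalso
      cases u <;> simp at h
    | cons b v =>
      simp only [List.nil_append, List.flatMap_cons, List.cons_append,
        List.cons.injEq, true_and] at h
      obtain ⟨h1, h2⟩ := ih h.2
      exact ⟨by rw [h.1, h1], h2⟩

theorem tuple_injective : Function.Injective (tuple (k := k)) := by
  intro l
  induction l with
  | nil =>
    intro m h
    cases m with
    | nil => rfl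
    | cons b m => simp [tuple, iota] at h
  | cons a l ih =>
    intro m h
    cases m with
    | nil => simp [tuple, iota] at h
    | cons b m =>
      simp only [tuple, List.flatMap_cons] at h
      obtain ⟨h1, h2⟩ := iota_append_inj h
      rw [h1, ih h2]

/-! ### Products of effective topological spaces -/

/-- Base sets of the binary product: `ν⟨u₁,u₂⟩ = ν₁(u₁) × ν₂(u₂)`. -/
def EffSpace.prodNu (X Y : EffSpace.{u} k) (w : Word k) : Set (X × Y) :=
  {z | ∃ u₁ u₂, w = tuple [u₁, u₂] ∧ z ∈ X.nu u₁ ×ˢ Y.nu u₂}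

theorem EffSpace.prodNu_tuple (X Y : EffSpace.{u} k) (u₁ u₂ : Word k) :
    X.prodNu Y (tuple [u₁, u₂]) = X.nu u₁ ×ˢ Y.nu u₂ := by
  ext z
  constructor
  · rintro ⟨v₁, v₂, h, hz⟩
    have := tuple_injective h
    simp only [List.cons.injEq, and_true] at this
    rw [this.1, this.2]; exact hz
  · intro hz; exact ⟨u₁, u₂, rfl, hz⟩

/-- The binary product, with the product topology. -/
def EffSpace.prod (X Y : EffSpace.{u} k) : EffSpace.{u} k where
  carrier := X × Y
  t0 := inferInstance
  dom := {w | ∃ u₁ ∈ X.dom, ∃ u₂ ∈ Y.dom, w = tuple [u₁, u₂]}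
  nu := X.prodNu Y
  nu_off := by
    intro w hw
    rw [Set.eq_empty_iff_forall_notMem]
    rintro z ⟨u₁, u₂, h, hz⟩
    exact hw ⟨u₁, X.mem_dom hz.1, u₂, Y.mem_dom hz.2, h⟩
  isBase := by
    refine TopologicalSpace.isTopologicalBasis_of_isOpen_of_nhds ?_ ?_
    · rintro _ ⟨_, ⟨u₁, _, u₂, _, rfl⟩, rfl⟩
      rw [X.prodNu_tuple]
      exact (X.isOpen_nu u₁).prod (Y.isOpen_nu u₂)
    · rintro ⟨x, y⟩ U hz hU
      obtain ⟨V, W, hV, hW, hx, hy, hVW⟩ := isOpen_prod_iff.1 hU x y hz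
      obtain ⟨u₁, h₁, hx₁, hs₁⟩ := X.exists_nu hV hx
      obtain ⟨u₂, h₂, hx₂, hs₂⟩ := Y.exists_nu hW hy
      refine ⟨_, ⟨_, ⟨u₁, h₁, u₂, h₂, rfl⟩, rfl⟩, ?_, ?_⟩
      · rw [X.prodNu_tuple]; exact ⟨hx₁, hx₂⟩
      · rw [X.prodNu_tuple]; exact (Set.prod_mono hs₁ hs₂).trans hVW

/-- Base sets of the countable product (factors numbered from `0`):
`ν⟨u₀,…,uₘ₋₁⟩ = ν₀(u₀) × … × νₘ₋₁(uₘ₋₁) × Xₘ × Xₘ₊₁ × …`, `m ≥ 1`. -/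
def EffSpace.piNu (X : ℕ → EffSpace.{u} k) (w : Word k) : Set (∀ i, X i) :=
  {x | ∃ l : List (Word k), l ≠ [] ∧ w = tuple l ∧ (∀ i (h : i < l.length), x i ∈ (X i).nu l[i])}

theorem EffSpace.piNu_tuple (X : ℕ → EffSpace.{u} k) {l : List (Word k)} (hl : l ≠ []) :
    EffSpace.piNu X (tuple l) = {x | ∀ i (h : i < l.length), x i ∈ (X i).nu l[i]} := by
  ext x
  constructor
  · rintro ⟨m, _, h, hx⟩
    obtain rfl := tuple_injective h
    exact hx
  · intro hx; exact ⟨l, hl, rfl, hx⟩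

/-- The countable product, with the product topology. -/
def EffSpace.pi (X : ℕ → EffSpace.{u} k) : EffSpace.{u} k where
  carrier := ∀ i, X i
  t0 := inferInstance
  dom := {w | ∃ l : List (Word k), l ≠ [] ∧ w = tuple l ∧
    ∀ i (h : i < l.length), l[i] ∈ (X i).dom}
  nu := EffSpace.piNu X
  nu_off := by
    intro w hw
    rw [Set.eq_empty_iff_forall_notMem]
    rintro x ⟨l, hl, h, hx⟩
    exact hw ⟨l, hl, h, fun i hi => (X i).mem_dom (hx i hi)⟩
  isBase := by
    refine TopologicalSpace.isTopologicalBasis_of_isOpen_of_nhds ?_ ?_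
    · rintro _ ⟨_, ⟨l, hl, rfl, _⟩, rfl⟩
      rw [EffSpace.piNu_tuple X hl]
      have : {x : ∀ i, X i | ∀ i (h : i < l.length), x i ∈ (X i).nu l[i]} =
          ⋂ i : Fin l.length, (fun x : ∀ i, X i => x i) ⁻¹' (X i).nu l[i] := by
        ext x
        simp only [Set.mem_ofPred_eq, Set.mem_iInter, Set.mem_preimage]
        exact ⟨fun h i => h i i.2, fun h i hi => h ⟨i, hi⟩⟩
      rw [this]
      exact isOpen_iInter_of_finite fun i =>
        ((X i).isOpen_nu _).preimage (continuous_apply (i : ℕ))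
    · intro x U hx hU
      obtain ⟨I, V, hV, hVU⟩ := isOpen_pi_iff.1 hU x hx
      have key : ∀ i, ∃ w ∈ (X i).dom, x i ∈ (X i).nu w ∧ (i ∈ I → (X i).nu w ⊆ V i) := by
        intro i
        by_cases hi : i ∈ I
        · obtain ⟨w, h1, h2, h3⟩ := (X i).exists_nu (hV i hi).1 (hV i hi).2
          exact ⟨w, h1, h2, fun _ => h3⟩
        · obtain ⟨w, h1, h2, _⟩ := (X i).exists_nu isOpen_univ (Set.mem_univ (x i))
          exact ⟨w, h1, h2, fun h => absurd h hi⟩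
      choose w hw hxw hwV using key
      have hl : (List.range (I.sup id + 1)).map w ≠ [] := by simp
      refine ⟨_, ⟨_, ⟨(List.range (I.sup id + 1)).map w, hl, rfl, ?_⟩, rfl⟩, ?_, ?_⟩
      · intro i hi; simpa using hw i
      · rw [EffSpace.piNu_tuple X hl]
        intro i hi; simpa using hxw i
      · rw [EffSpace.piNu_tuple X hl]
        intro y hy
        refine hVU fun i hi => hwV i hi ?_
        have hlt : i < I.sup id + 1 := Nat.lt_succ_of_le (Finset.le_sup (f := id) hi)
        have hlen : i < ((List.range (I.sup id + 1)).map w).length := by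
          rw [List.length_map, List.length_range]; exact hlt
        have := hy i hlen
        rwa [List.getElem_map, List.getElem_range] at this

/-! ### Names of spaces and of compact sets -/

/-- The graph of the characteristic function of `dom ν`, as a set of words. -/
def EffSpace.charGraph (X : EffSpace.{u} k) : Set (Word k) :=
  {w | ∃ u, (u ∈ X.dom ∧ w = tuple [u, [1]]) ∨ (u ∉ X.dom ∧ w = tuple [u, [0]])}

/-- The multi-representation `Δ` of the effective topological spaces: `⟨r,s⟩` is a name of `X` if
`r` enumerates the graph of the characteristic function of `dom ν`, and `s` enumerates some
`S ⊆ (dom ν)³` with `ν(u) ∩ ν(v) = ⋃ {ν(w) | (u,v,w) ∈ S}` for `u, v ∈ dom ν`. -/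
def Delta : MultiRep k (EffSpace.{u} k) := fun p X =>
  ∃ r s, p = seqPair r s ∧ Enumerates r X.charGraph ∧
    ∃ S : Set (Word k × Word k × Word k),
      (∀ a ∈ S, a.1 ∈ X.dom ∧ a.2.1 ∈ X.dom ∧ a.2.2 ∈ X.dom) ∧
      Enumerates s ((fun a => tuple [a.1, a.2.1, a.2.2]) '' S) ∧
      ∀ u ∈ X.dom, ∀ v ∈ X.dom, X.nu u ∩ X.nu v = ⋃ w ∈ {w | (u, v, w) ∈ S}, X.nu w

/-- The words `w` that code (through all `v ≪ w`) a finite set of base elements covering `K`. -/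
def EffSpace.finCovers (X : EffSpace.{u} k) (K : Set X) : Set (Word k) :=
  {w | (∀ v, InWord v w → v ∈ X.dom) ∧ K ⊆ ⋃ v ∈ {v | InWord v w}, X.nu v}

/-- The class of pairs `(X,K)` of an effective topological space and a compact subset. -/
structure CompactPair (k : ℕ) where
  space : EffSpace.{u} k
  set : Set space
  isCompact : IsCompact set

/-- The multi-representation `κ^Δ`: `⟨r,s⟩` is a name of `(X,K)` if `r` is a `Δ`-name of `X` and
`s` is a list of all finite base covers of `K`. -/
def kappaDelta : MultiRep k (CompactPair.{u} k) := fun p A =>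
  ∃ r s, p = seqPair r s ∧ Delta r A.space ∧ Enumerates s (A.space.finCovers A.set)

/-! ### Products of pairs -/

/-- `((X₁,K₁),(X₂,K₂)) ↦ (X₁ × X₂, K₁ × K₂)`. -/
def CompactPair.prod (A B : CompactPair.{u} k) : CompactPair.{u} k where
  space := A.space.prod B.space
  set := A.set ×ˢ B.set
  isCompact := A.isCompact.prod B.isCompact

/-- The product of `n + 1` pairs, bracketed to the left as
`((…((X₁ × X₂) × X₃)…) × Xₙ₊₁, (…((K₁ × K₂) × K₃)…) × Kₙ₊₁)`; for one pair it is that pair. -/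
def CompactPair.finProd : (n : ℕ) → (Fin (n + 1) → CompactPair.{u} k) → CompactPair.{u} k
  | 0, A => A 0
  | n + 1, A => (CompactPair.finProd n fun i => A i.castSucc).prod (A (Fin.last (n + 1)))

/-- `((X₁,K₁),(X₂,K₂),…) ↦ (X₁ × X₂ × …, K₁ × K₂ × …)`. -/
def CompactPair.pi (A : ℕ → CompactPair.{u} k) : CompactPair.{u} k where
  space := EffSpace.pi fun i => (A i).space
  set := Set.pi Set.univ fun i => (A i).set
  isCompact := isCompact_univ_pi fun i => (A i).isCompact

end TTE

/-!
A `κ^Δ`-name lists four sets: the domain of the base notation, its complement, an intersection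
relation and the finite covers of the compact set. A machine can list every set that is
semidecidable relative to its input, by writing the words it confirms and the filler `1` in
between. It therefore suffices to show that the four sets of a product are semidecidable relative
to those of the factors.

Finite and countable products are treated alike: the points of the product are families of points,
and a word codes a box, that is, a finite list of sides, with no condition on the remaining
factors. A word fails to code a box of base sets if it has the wrong form or one of its sides is
outside the domain, which is what makes the complement of the domain semidecidable. Boxes intersect
side by side. For the covers, distributivity turns a finite union of boxes into an intersection,
over all choices of one side from every box, of unions of slabs `{x | x i ∈ ν v}`; and a union of
slabs covers `∏ K i` if and only if for some `i` the chosen sides in the `i`-th factor cover `K i`.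
-/

namespace TTE

variable {k : ℕ}

/-! ### Occurrences of wrapped words -/

theorem iota_eq_cons (w : Word k) :
    iota w = 1 :: 1 :: (w.flatMap (fun a => [0, a]) ++ [0, 1, 1]) := rfl

theorem length_iota (w : Word k) : (iota w).length = 2 * w.length + 5 := by
  simp only [iota, List.length_append, List.length_flatMap, List.length_cons, List.length_nil,
    List.map_const', List.sum_replicate, smul_eq_mul]
  ring

theorem iota_prefix_unique {u v w : Word k} (hu : iota u <+: w) (hv : iota v <+: w) : u = v := by
  obtain ⟨s, rfl⟩ := hu
  obtain ⟨t, ht⟩ := hv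
  exact (iota_append_inj ht).1.symm

/-- The symbols at the positions `3, 5, …, 2n + 1`: the only candidate of length `n` for a word `v`
such that `ι(v)` is a prefix of `w`. -/
def bodyAt (w : Word k) (n : ℕ) : Word k := (List.range n).map fun m => w.getD (2 * m + 3) 0

theorem getElem?_iota_append (v t : Word k) {m : ℕ} (h : m < v.length) :
    (iota v ++ t)[2 * m + 3]? = v[m]? := by
  simp only [iota, List.append_assoc, List.cons_append, List.nil_append,
    List.getElem?_cons_succ]
  induction v generalizing m with
  | nil => exact absurd h (Nat.not_lt_zero m)
  | cons a v ih =>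
    cases m with
    | zero => rfl
    | succ m => simpa [Nat.mul_add] using ih (Nat.lt_of_succ_lt_succ h)

theorem bodyAt_iota_append (v t : Word k) : bodyAt (iota v ++ t) v.length = v := by
  refine List.ext_getElem (by simp [bodyAt]) fun m _ hm => ?_
  simp [bodyAt, getElem?_iota_append v t hm, hm]

/-- The word `v`, if any, such that `ι(v)` is a prefix of `w`. -/
def headWord (w : Word k) : Option (Word k) :=
  ((List.range w.length).map (bodyAt w)).find? fun v => iota v <+: w

theorem headWord_eq_some {v w : Word k} : headWord w = some v ↔ iota v <+: w := by
  have sound : ∀ {u}, headWord w = some u → iota u <+: w := fun h => by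
    simpa using List.find?_some h
  refine ⟨sound, fun h => ?_⟩
  have hv : v ∈ (List.range w.length).map (bodyAt w) := by
    obtain ⟨t, rfl⟩ := h
    refine List.mem_map.2 ⟨v.length, ?_, bodyAt_iota_append v t⟩
    rw [List.mem_range, List.length_append, length_iota]
    omega
  have found : (headWord w).isSome := List.find?_isSome.2 ⟨v, hv, by simpa using h⟩
  obtain ⟨u, hu⟩ := Option.isSome_iff_exists.1 found
  rw [hu, iota_prefix_unique (sound hu) h]

theorem headWord_eq_none {w : Word k} (h : ¬ [1, 1, 0] <+: w) : headWord w = none := by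
  refine Option.eq_none_iff_forall_ne_some.2 fun v hv => h (.trans ?_ (headWord_eq_some.1 hv))
  cases v <;> simp [iota_eq_cons]

/-- The words `v` with `v ≪ w`, in the order of their occurrences in `w`. -/
def parts (w : Word k) : List (Word k) :=
  (List.range w.length).filterMap fun i => headWord (w.drop i)

theorem parts_cons (a : Sym k) (w : Word k) :
    parts (a :: w) = (headWord (a :: w)).toList ++ parts w := by
  rw [parts, List.length_cons, List.range_succ_eq_map, List.filterMap_cons, List.filterMap_map,
    List.drop_zero]
  cases headWord (a :: w) <;> rfl

theorem mem_parts {v w : Word k} : v ∈ parts w ↔ InWord v w := by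
  induction w with
  | nil => simp [InWord, iota_eq_cons, parts]
  | cons a w ih =>
    rw [parts_cons, List.mem_append, ih, Option.mem_toList, headWord_eq_some]
    exact List.infix_cons_iff.symm

theorem parts_cons_of_not_prefix {a : Sym k} {w : Word k} (h : ¬ [1, 1, 0] <+: a :: w) :
    parts (a :: w) = parts w := by
  rw [parts_cons, headWord_eq_none h]; rfl

theorem parts_flatMap_append (u t : Word k) (ht : [0] <+: t) :
    parts (u.flatMap (fun a => [0, a]) ++ t) = parts t := by
  induction u with
  | nil => rfl
  | cons a u ih =>
    have zero_prefix : [0] <+: u.flatMap (fun a => [0, a]) ++ t := by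
      cases u
      · exact ht
      · simp
    obtain ⟨s, hs⟩ := zero_prefix
    rw [List.flatMap_cons, List.append_assoc, List.cons_append, List.cons_append, List.nil_append,
      parts_cons_of_not_prefix (by simp), parts_cons_of_not_prefix, ih]
    simp [← hs]

/-- The words that can follow a wrapped word without creating further occurrences. -/
def Separates (w : Word k) : Prop := ¬ [0] <+: w ∧ ¬ [1, 0] <+: w

theorem parts_iota_append (u : Word k) {w : Word k} (hw : Separates w) :
    parts (iota u ++ w) = u :: parts w := by
  have head : headWord (iota u ++ w) = some u := headWord_eq_some.2 (List.prefix_append _ _)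
  have body : parts (u.flatMap (fun a => [0, a]) ++ ([0, 1, 1] ++ w)) = parts w := by
    obtain ⟨h0, h10⟩ := hw
    rw [parts_flatMap_append _ _ (by simp), List.cons_append, parts_cons_of_not_prefix (by simp),
      List.cons_append, parts_cons_of_not_prefix (by simpa using h0), List.cons_append,
      parts_cons_of_not_prefix (by simpa using h10), List.nil_append]
  have tail : ¬ [1, 1, 0] <+: 1 :: (u.flatMap (fun a => [0, a]) ++ ([0, 1, 1] ++ w)) := by
    cases u <;> simp
  rw [iota_eq_cons, List.cons_append, List.cons_append, List.append_assoc] at head ⊢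
  rw [parts_cons, head, parts_cons_of_not_prefix tail, body]
  rfl

/-- A block of an output sequence: a wrapped word or the filler `1`. -/
def block : Option (Word k) → Word k
  | some v => iota v
  | none => [1]

theorem separates_flatMap_block (l : List (Option (Word k))) : Separates (l.flatMap block) := by
  have not_zero : ∀ l : List (Option (Word k)), ¬ [0] <+: l.flatMap block := by
    rintro (_ | ⟨_ | v, l⟩) <;> simp [block, iota_eq_cons]
  refine ⟨not_zero l, ?_⟩
  rcases l with _ | ⟨_ | v, l⟩
  · simp
  · simpa [block] using not_zero l
  · simp [block, iota_eq_cons]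

theorem parts_flatMap_block (l : List (Option (Word k))) :
    parts (l.flatMap block) = l.reduceOption := by
  induction l with
  | nil => rfl
  | cons b l ih =>
    have hl := separates_flatMap_block l
    cases b with
    | none =>
      rw [List.flatMap_cons, block, List.cons_append, List.nil_append,
        parts_cons_of_not_prefix (by simpa using hl.2), ih, List.reduceOption_cons_of_none]
    | some v =>
      rw [List.flatMap_cons, block, parts_iota_append v hl, ih, List.reduceOption_cons_of_some]

theorem inWord_flatMap_block {v : Word k} {l : List (Option (Word k))} :
    InWord v (l.flatMap block) ↔ some v ∈ l := by
  rw [← mem_parts, parts_flatMap_block, List.reduceOption_mem_iff]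

@[simp] theorem parts_tuple (l : List (Word k)) : parts (tuple l) = l := by
  have blocks : tuple l = (l.map some).flatMap block := by rw [List.flatMap_map]; rfl
  rw [blocks, parts_flatMap_block, List.reduceOption, List.filterMap_map]
  exact List.filterMap_some

/-! ### Primitive recursive operations on words -/

open Primrec

theorem primrec_iota : Primrec (iota (k := k)) :=
  list_append.comp (list_append.comp (.const _) (list_flatMap .id
    (list_cons.comp (.const _) (list_cons.comp .snd (.const _))).to₂)) (.const _)

theorem primrec_tuple : Primrec (tuple (k := k)) :=
  list_flatMap .id (primrec_iota.comp .snd).to₂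

theorem primrec_tuple_pair (c : Word k) : Primrec fun u : Word k => tuple [u, c] :=
  primrec_tuple.comp (list_cons.comp .id (.const [c]))

theorem primrec_tuple_triple :
    Primrec fun a : Word k × Word k × Word k => tuple [a.1, a.2.1, a.2.2] :=
  primrec_tuple.comp (list_cons.comp .fst (list_cons.comp (Primrec.fst.comp .snd)
    (list_cons.comp (Primrec.snd.comp .snd) (.const []))))

theorem primrec_block : Primrec (block (k := k)) := by
  refine (option_casesOn (o := fun o : Option (Word k) => o) .id (.const [1])
    (primrec_iota.comp .snd).to₂).of_eq fun o => ?_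
  cases o <;> rfl

theorem primrec_bodyAt : Primrec₂ (bodyAt (k := k)) :=
  list_map (list_range.comp .snd) ((list_getD 0).comp (Primrec.fst.comp .fst)
    (nat_add.comp (nat_mul.comp (.const 2) .snd) (.const 3))).to₂

theorem primrecRel_isPrefix {α : Type*} [Primcodable α] :
    PrimrecRel fun u w : List α => u <+: w :=
  (Primrec.eq.comp .fst (list_take.comp (list_length.comp .fst) .snd)).of_eq
    fun _ => List.prefix_iff_eq_take.symm

theorem primrec_headWord : Primrec (headWord (k := k)) := by
  have isHead : PrimrecRel fun (v w : Word k) => iota v <+: w :=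
    primrecRel_isPrefix.comp (primrec_iota.comp .fst) .snd
  exact (list_head?.comp (isHead.listFilter.comp
    (list_map (list_range.comp list_length) primrec_bodyAt) .id)).of_eq fun _ => List.head?_filter

theorem primrec_parts : Primrec (parts (k := k)) :=
  listFilterMap (list_range.comp list_length)
    (primrec_headWord.comp (list_drop.comp .snd .fst)).to₂

theorem primrec_sections {α : Type*} [Primcodable α] : Primrec (List.sections (α := α)) := by
  have recursion : Primrec fun L : List (List α) => L.foldr
      (fun l acc => acc.flatMap fun s => l.map fun a => a :: s) [[]] :=
    list_foldr .id (.const _) (list_flatMap (Primrec.snd.comp .snd)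
      (list_map (Primrec.fst.comp (Primrec.snd.comp .fst))
        (list_cons.comp .snd (Primrec.snd.comp .fst)).to₂).to₂).to₂
  refine recursion.of_eq fun L => ?_
  induction L with
  | nil => rfl
  | cons l L ih => rw [List.foldr_cons, ih]; rfl

theorem primrec_zipIdx {α : Type*} [Primcodable α] :
    Primrec fun l : List α => l.zipIdx := by
  have recursion : Primrec fun l : List α =>
      l.foldl (fun acc a => acc ++ [(a, acc.length)]) [] :=
    list_foldl .id (.const _) (list_concat.comp (Primrec.fst.comp .snd) (Primrec.pair
      (Primrec.snd.comp .snd) (list_length.comp (Primrec.fst.comp .snd)))).to₂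
  refine recursion.of_eq fun l => ?_
  induction l using List.reverseRecOn with
  | nil => rfl
  | append_singleton l a ih =>
    rw [List.foldl_append, ih, List.zipIdx_append, List.foldl_cons, List.foldl_nil,
      List.length_zipIdx, List.zipIdx_singleton, Nat.zero_add]

open Filter

/-! ### Prefixes and tuples of sequences -/

@[simp] theorem length_pre (p : Seq k) (n : ℕ) : (pre p n).length = n := by
  rw [pre, List.length_map, List.length_range]

theorem pre_succ (p : Seq k) (n : ℕ) : pre p (n + 1) = pre p n ++ [p n] := by
  simp [pre, List.range_succ]

theorem pre_add (p : Seq k) (m n : ℕ) :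
    pre p (m + n) = pre p m ++ pre (fun i => p (m + i)) n := by
  simp [pre, List.range_add]

theorem getElem?_pre (p : Seq k) (n i : ℕ) :
    (pre p n)[i]? = if i < n then some (p i) else none := by
  simp [pre]
  split_ifs <;> simp [*]

theorem take_pre (p : Seq k) {m n : ℕ} (h : m ≤ n) : (pre p n).take m = pre p m := by
  simp [pre, ← List.map_take, List.take_range, h]

theorem pre_length_eq_iff {p : Seq k} {w : Word k} :
    pre p w.length = w ↔ ∀ i ∈ List.range w.length, p i = w.getD i 0 := by
  constructor
  · intro h i hi
    conv_rhs => rw [← h]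
    simp [pre, List.mem_range.1 hi]
  · intro h
    refine List.ext_getElem (length_pre p _) fun i _ hi => ?_
    simpa [pre, hi] using h i (List.mem_range.2 hi)

theorem inSeq_iff {x : Word k} {r : Seq k} :
    InSeq x r ↔ ∃ m, pre (fun i => r (m + i)) (iota x).length = iota x := by
  constructor
  · rintro ⟨n, s, t, h⟩
    have hn : n = s.length + (iota x).length + t.length := by
      simpa [Nat.add_assoc] using (congrArg List.length h).symm
    refine ⟨s.length, ?_⟩
    rw [hn, pre_add, pre_add] at h
    exact (List.append_inj (List.append_inj h (by simp)).1 (by simp)).2.symm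
  · rintro ⟨m, h⟩
    exact ⟨m + (iota x).length, pre r m, [], by rw [pre_add, h, List.append_nil]⟩

theorem seqTuple_apply {n : ℕ} (p : Fin (n + 1) → Seq k) (i : Fin (n + 1)) (j : ℕ) :
    seqTuple p (j * (n + 1) + i) = p i j := by
  have hi : Fin.ofNat (n + 1) (j * (n + 1) + i) = i := by
    ext
    simp [Nat.mod_eq_of_lt i.isLt]
  have hj : (j * (n + 1) + i) / (n + 1) = j := by
    rw [Nat.mul_comm, Nat.mul_add_div n.succ_pos, Nat.div_eq_of_lt i.isLt, Nat.add_zero]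
  rw [seqTuple, hi, hj]

/-- The first component of the sequence `q`, read as a pair of sequences. -/
def evens (q : Seq k) : Seq k := fun j => q (2 * j)

/-- The second component of the sequence `q`, read as a pair of sequences. -/
def odds (q : Seq k) : Seq k := fun j => q (2 * j + 1)

@[simp] theorem evens_seqPair (p q : Seq k) : evens (seqPair p q) = p := by
  funext j
  simpa [evens, seqPair, Nat.mul_comm] using seqTuple_apply ![p, q] 0 j

@[simp] theorem odds_seqPair (p q : Seq k) : odds (seqPair p q) = q := by
  funext j
  simpa [odds, seqPair, Nat.mul_comm] using seqTuple_apply ![p, q] 1 j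

/-! ### Machines that write one symbol for every symbol read -/

/-- A map on sequences whose `n`-th output symbol is a primitive recursive function of the first
`n + 1` input symbols: it is computed by a machine that never waits. -/
def Causal (F : Seq k → Seq k) : Prop :=
  ∃ G : Word k → Sym k, Primrec G ∧ ∀ p n, F p n = G (pre p (n + 1))

theorem out_run_prefix (M : Machine k) (p : Seq k) {s t : ℕ} (h : s ≤ t) :
    (M.run p s).out <+: (M.run p t).out := by
  induction t, h using Nat.le_induction with
  | base => exact List.prefix_rfl
  | succ t _ ih => exact ih.trans (List.prefix_append _ _)

theorem writes_unique {M : Machine k} {p q q' : Seq k} (h : M.Writes p q) (h' : M.Writes p q') :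
    q = q' := by
  funext n
  obtain ⟨s, hs⟩ := h (n + 1)
  obtain ⟨t, ht⟩ := h' (n + 1)
  have pre_eq : pre q (n + 1) = pre q' (n + 1) :=
    (List.prefix_of_prefix_length_le (hs.trans (out_run_prefix M p (le_max_left s t)))
      (ht.trans (out_run_prefix M p (le_max_right s t))) (by simp)).eq_of_length (by simp)
  simpa [pre_succ] using congrArg List.getLast? pre_eq

theorem Causal.computableSeqFun {F : Seq k → Seq k} (hF : Causal F) :
    ComputableSeqFun fun p => Part.some (F p) := by
  obtain ⟨G, hG, hFG⟩ := hF
  have concat : Primrec fun c : Word k × Sym k => c.1 ++ [c.2] := list_concat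
  let M : Machine k :=
    { Mem := Word k
      init := []
      step := fun c => (c.1 ++ [c.2], true, some (G (c.1 ++ [c.2])))
      step_computable := (Primrec.pair concat
        (Primrec.pair (.const true) (option_some.comp (hG.comp concat)))).to_comp }
  have run_eq : ∀ p n, M.run p n = ⟨pre p n, n, pre (F p) n⟩ := by
    intro p n
    induction n with
    | zero => rfl
    | succ n ih =>
      rw [Machine.run, ih, pre_succ p, pre_succ (F p), hFG, pre_succ p]
      rfl
  have writes : ∀ p, M.Writes p (F p) := fun p n => ⟨n, by rw [run_eq]⟩
  refine ⟨M, fun p q => ⟨fun h => ?_, fun h => ?_⟩⟩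
  · rw [Part.mem_some_iff.1 h]
    exact writes p
  · exact Part.mem_some_iff.2 (writes_unique h (writes p))

theorem Causal.seqPair {F₁ F₂ : Seq k → Seq k} (h₁ : Causal F₁) (h₂ : Causal F₂) :
    Causal fun p => seqPair (F₁ p) (F₂ p) := by
  obtain ⟨G₁, hG₁, h₁⟩ := h₁
  obtain ⟨G₂, hG₂, h₂⟩ := h₂
  have last : Primrec fun w : Word k => w.length - 1 := nat_sub.comp list_length (.const 1)
  have half : Primrec fun w : Word k => w.take ((w.length - 1) / 2 + 1) :=
    list_take.comp (Primrec.succ.comp (nat_div.comp last (.const 2))) .id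
  refine ⟨fun w => if (w.length - 1) % 2 = 0 then G₁ (w.take ((w.length - 1) / 2 + 1))
    else G₂ (w.take ((w.length - 1) / 2 + 1)),
    Primrec.ite (Primrec.eq.comp (nat_mod.comp last (.const 2)) (.const 0))
      (hG₁.comp half) (hG₂.comp half), fun p n => ?_⟩
  dsimp only
  rw [length_pre, Nat.add_sub_cancel, take_pre p (by omega), ← h₁, ← h₂]
  obtain ⟨j, rfl | rfl⟩ := n.even_or_odd'
  · have := congrFun (evens_seqPair (F₁ p) (F₂ p)) j
    simpa [evens] using this
  · have := congrFun (odds_seqPair (F₁ p) (F₂ p)) j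
    simp only [odds] at this
    rw [this, if_neg (by omega)]
    congr 1
    omega

/-! ### Sequences made of blocks -/

/-- The concatenation of the first `n` blocks. -/
def blockText (b : ℕ → Option (Word k)) (n : ℕ) : Word k :=
  (List.range n).flatMap fun i => block (b i)

/-- The infinite concatenation of the blocks `b 0, b 1, …`. As no block is empty, the symbol
at position `n` lies in the first `n + 1` blocks, and the default value of `getD` is not used. -/
def blockSeq (b : ℕ → Option (Word k)) : Seq k := fun n => (blockText b (n + 1)).getD n 1

theorem blockText_succ (b : ℕ → Option (Word k)) (n : ℕ) :
    blockText b (n + 1) = blockText b n ++ block (b n) := by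
  simp [blockText, List.range_succ]

theorem le_length_blockText (b : ℕ → Option (Word k)) (n : ℕ) : n ≤ (blockText b n).length := by
  induction n with
  | zero => exact Nat.zero_le _
  | succ n ih =>
    have block_pos : 1 ≤ (block (b n)).length := by cases b n <;> simp [block, length_iota]
    rw [blockText_succ, List.length_append]
    omega

theorem blockText_prefix (b : ℕ → Option (Word k)) {m n : ℕ} (h : m ≤ n) :
    blockText b m <+: blockText b n := by
  induction n, h using Nat.le_induction with
  | base => exact List.prefix_rfl
  | succ n _ ih => rw [blockText_succ]; exact ih.trans (List.prefix_append _ _)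

theorem pre_blockSeq (b : ℕ → Option (Word k)) (n : ℕ) :
    pre (blockSeq b) n <+: blockText b n := by
  suffices pre (blockSeq b) n = (blockText b n).take n from this ▸ List.take_prefix _ _
  refine List.ext_getElem? fun i => ?_
  rw [getElem?_pre, List.getElem?_take]
  split_ifs with hi
  · have hlen := le_length_blockText b (i + 1)
    rw [blockSeq, List.getD_eq_getElem _ _ (by omega), (blockText_prefix b hi).getElem hlen,
      List.getElem?_eq_getElem]
  · rfl

theorem inWord_blockText {b : ℕ → Option (Word k)} {v : Word k} {n : ℕ} :
    InWord v (blockText b n) ↔ ∃ i < n, b i = some v := by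
  have blocks : blockText b n = ((List.range n).map b).flatMap block := by
    rw [List.flatMap_map]; rfl
  rw [blocks, inWord_flatMap_block]
  simp

theorem enumerates_blockSeq (b : ℕ → Option (Word k)) :
    Enumerates (blockSeq b) {v | ∃ i, b i = some v} := by
  intro v
  constructor
  · rintro ⟨n, hn⟩
    obtain ⟨i, _, hi⟩ := inWord_blockText.1 (hn.trans (pre_blockSeq b n).isInfix)
    exact ⟨i, hi⟩
  · rintro ⟨i, hi⟩
    have hv : InWord v (blockText b (i + 1)) := inWord_blockText.2 ⟨i, i.lt_succ_self, hi⟩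
    have text_prefix : blockText b (i + 1) <+: pre (blockSeq b) (blockText b (i + 1)).length :=
      List.prefix_of_prefix_length_le (blockText_prefix b (le_length_blockText b (i + 1)))
        (pre_blockSeq b _) (by rw [length_pre])
    exact ⟨_, hv.trans text_prefix.isInfix⟩

theorem causal_blockSeq {stage : Word k → Option (Word k)} (h : Primrec stage) :
    Causal fun p => blockSeq fun n => stage (pre p n) := by
  refine ⟨fun w =>
    ((List.range w.length).flatMap fun i => block (stage (w.take i))).getD (w.length - 1) 1,
    ?_, fun p n => ?_⟩
  · exact (list_getD 1).comp (list_flatMap (list_range.comp list_length)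
      (primrec_block.comp (h.comp (list_take.comp .snd .fst))).to₂)
      (nat_sub.comp list_length (.const 1))
  · simp only [blockSeq, blockText, length_pre, Nat.add_sub_cancel]
    congr 1
    refine List.flatMap_congr fun i hi => ?_
    rw [take_pre p (List.mem_range.1 hi).le]

/-! ### Predicates that are semidecidable relative to a sequence -/

/-- `φ p a` can be confirmed by inspecting a finite prefix of `p`: semidecidability relative to an
oracle `p`, with a primitive recursive test `R` that is correct on every prefix and eventually
successful. -/
def SemiDec {α : Type*} [Primcodable α] (φ : Seq k → α → Prop) : Prop :=
  ∃ R : Word k → α → Prop, PrimrecRel R ∧ (∀ p n a, R (pre p n) a → φ p a) ∧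
    ∀ p a, φ p a → ∀ᶠ n in atTop, R (pre p n) a

namespace SemiDec

variable {α β : Type*} [Primcodable α] [Primcodable β]

theorem of_iff {φ ψ : Seq k → α → Prop} (h : SemiDec φ) (H : ∀ p a, ψ p a ↔ φ p a) :
    SemiDec ψ := by
  obtain rfl : ψ = φ := by
    funext p a
    exact propext (H p a)
  exact h

theorem of_primrec {φ : α → Prop} (h : PrimrecPred φ) : SemiDec fun (_ : Seq k) a => φ a :=
  ⟨fun _ a => φ a, h.comp .snd, fun _ _ _ h => h, fun _ _ h => .of_forall fun _ => h⟩

theorem comp {φ : Seq k → β → Prop} (h : SemiDec φ) {f : α → β} (hf : Primrec f) :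
    SemiDec fun p a => φ p (f a) := by
  obtain ⟨R, hR, sound, complete⟩ := h
  exact ⟨fun w a => R w (f a), hR.comp .fst (hf.comp .snd), fun p n _ => sound p n _,
    fun p _ => complete p _⟩

protected theorem and {φ ψ : Seq k → α → Prop} (hφ : SemiDec φ) (hψ : SemiDec ψ) :
    SemiDec fun p a => φ p a ∧ ψ p a := by
  obtain ⟨R, hR, sound, complete⟩ := hφ
  obtain ⟨R', hR', sound', complete'⟩ := hψ
  exact ⟨fun w a => R w a ∧ R' w a, PrimrecPred.and hR hR',
    fun p n a h => ⟨sound p n a h.1, sound' p n a h.2⟩,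
    fun p a h => (complete p a h.1).and (complete' p a h.2)⟩

protected theorem or {φ ψ : Seq k → α → Prop} (hφ : SemiDec φ) (hψ : SemiDec ψ) :
    SemiDec fun p a => φ p a ∨ ψ p a := by
  obtain ⟨R, hR, sound, complete⟩ := hφ
  obtain ⟨R', hR', sound', complete'⟩ := hψ
  exact ⟨fun w a => R w a ∨ R' w a, PrimrecPred.or hR hR',
    fun p n a h => h.imp (sound p n a) (sound' p n a),
    fun p a h => h.elim (fun h => (complete p a h).mono fun _ => Or.inl)
      fun h => (complete' p a h).mono fun _ => Or.inr⟩

theorem exists_mem {φ : Seq k → α → β → Prop} {F : α → List β} (hF : Primrec F)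
    (h : SemiDec fun p (x : α × β) => φ p x.1 x.2) :
    SemiDec fun p a => ∃ b ∈ F a, φ p a b := by
  obtain ⟨R, hR, sound, complete⟩ := h
  have test : PrimrecRel fun (b : β) (x : Word k × α) => R x.1 (x.2, b) :=
    hR.comp (Primrec.fst.comp .snd) (Primrec.pair (Primrec.snd.comp .snd) .fst)
  refine ⟨fun w a => ∃ b ∈ F a, R w (a, b), test.exists_mem_list.comp (hF.comp .snd) .id, ?_, ?_⟩
  · rintro p n a ⟨b, hb, h⟩
    exact ⟨b, hb, sound p n (a, b) h⟩
  · rintro p a ⟨b, hb, h⟩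
    exact (complete p (a, b) h).mono fun _ h => ⟨b, hb, h⟩

theorem forall_mem {φ : Seq k → α → β → Prop} {F : α → List β} (hF : Primrec F)
    (h : SemiDec fun p (x : α × β) => φ p x.1 x.2) :
    SemiDec fun p a => ∀ b ∈ F a, φ p a b := by
  obtain ⟨R, hR, sound, complete⟩ := h
  have test : PrimrecRel fun (b : β) (x : Word k × α) => R x.1 (x.2, b) :=
    hR.comp (Primrec.fst.comp .snd) (Primrec.pair (Primrec.snd.comp .snd) .fst)
  refine ⟨fun w a => ∀ b ∈ F a, R w (a, b), test.forall_mem_list.comp (hF.comp .snd) .id, ?_, ?_⟩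
  · exact fun p n a h b hb => sound p n (a, b) (h b hb)
  · exact fun p a h => (Set.Finite.eventually_all (l := atTop) (List.finite_toSet (F a))
      (p := fun b n => R (pre p n) (a, b))).2 fun b hb => complete p (a, b) (h b hb)

/-- The search for a witness `b` runs through the first `n` codes when a prefix of length `n` is
inspected. -/
theorem exists_of_prod {φ : Seq k → α → β → Prop} (h : SemiDec fun p (x : α × β) => φ p x.1 x.2) :
    SemiDec fun p a => ∃ b, φ p a b := by
  obtain ⟨R, hR, sound, complete⟩ := h
  have test : PrimrecRel fun (b : β) (x : Word k × α) => R x.1 (x.2, b) :=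
    hR.comp (Primrec.fst.comp .snd) (Primrec.pair (Primrec.snd.comp .snd) .fst)
  have candidates : Primrec fun x : Word k × α =>
      (List.range x.1.length).filterMap (Encodable.decode (α := β)) :=
    listFilterMap (list_range.comp (list_length.comp .fst)) (Primrec.decode.comp .snd).to₂
  refine ⟨fun w a => ∃ b ∈ (List.range w.length).filterMap (Encodable.decode (α := β)),
    R w (a, b), test.exists_mem_list.comp candidates .id, ?_, ?_⟩
  · rintro p n a ⟨b, _, hb⟩
    exact ⟨b, sound p n (a, b) hb⟩
  · rintro p a ⟨b, hb⟩
    filter_upwards [complete p (a, b) hb, eventually_gt_atTop (Encodable.encode b)] with n hn hlt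
    exact ⟨b, List.mem_filterMap.2 ⟨Encodable.encode b, by simpa using hlt,
      Encodable.encodek b⟩, hn⟩

theorem symbol_eq {f : α → ℕ} {g : α → Sym k} (hf : Primrec f) (hg : Primrec g) :
    SemiDec fun p a => p (f a) = g a := by
  refine ⟨fun w a => w[f a]? = some (g a), Primrec.eq.comp
    (list_getElem?.comp .fst (hf.comp .snd)) (option_some.comp (hg.comp .snd)), ?_, ?_⟩
  · intro p n a h
    rw [getElem?_pre] at h
    split_ifs at h
    exact Option.some_injective _ h
  · intro p a h
    filter_upwards [eventually_gt_atTop (f a)] with n hn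
    rw [getElem?_pre, if_pos hn, h]

theorem inSeq {pos : α → ℕ → ℕ} {f : α → Word k} (hpos : Primrec₂ pos) (hf : Primrec f) :
    SemiDec fun p a => InSeq (f a) fun j => p (pos a j) := by
  have hiota : Primrec fun x : α × ℕ => iota (f x.1) := primrec_iota.comp (hf.comp .fst)
  have symbols : SemiDec fun (p : Seq k) (x : (α × ℕ) × ℕ) =>
      p (pos x.1.1 (x.1.2 + x.2)) = (iota (f x.1.1)).getD x.2 0 :=
    symbol_eq (hpos.comp (Primrec.fst.comp .fst) (nat_add.comp (Primrec.snd.comp .fst) .snd))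
      ((list_getD 0).comp (hiota.comp .fst) .snd)
  have matches_at : SemiDec fun (p : Seq k) (x : α × ℕ) =>
      ∀ i ∈ List.range (iota (f x.1)).length,
        p (pos x.1 (x.2 + i)) = (iota (f x.1)).getD i 0 :=
    forall_mem (list_range.comp (list_length.comp hiota)) symbols
  refine (exists_of_prod (φ := fun p a m => ∀ i ∈ List.range (iota (f a)).length,
    p (pos a (m + i)) = (iota (f a)).getD i 0) matches_at).of_iff fun p a => ?_
  simp only [inSeq_iff, pre_length_eq_iff]

theorem exists_enumeration {φ : Seq k → Word k → Prop} (h : SemiDec φ) :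
    ∃ F : Seq k → Seq k, Causal F ∧ ∀ p, Enumerates (F p) {w | φ p w} := by
  classical
  obtain ⟨R, hR, sound, complete⟩ := h
  -- Stage `⟨c, N⟩` tests the word with code `c` on the prefix of length `⟨c, N⟩`, so that every
  -- word is tested on arbitrarily long prefixes.
  let stage : Word k → Option (Word k) := fun w =>
    (Encodable.decode (α := Word k) w.length.unpair.1).bind fun x =>
      if R w x then some x else none
  have hstage : Primrec stage := option_bind
    (Primrec.decode.comp (Primrec.fst.comp (Primrec.unpair.comp list_length)))
    (Primrec.ite hR (option_some.comp .snd) (.const none)).to₂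
  have listed : ∀ p, {w | φ p w} = {w | ∃ n, stage (pre p n) = some w} := by
    refine fun p => Set.ext fun w => ⟨fun hw => ?_, ?_⟩
    · obtain ⟨N, hN⟩ := eventually_atTop.1 (complete p w hw)
      exact ⟨Nat.pair (Encodable.encode w) N, by simp [stage, hN _ (Nat.right_le_pair _ _)]⟩
    · rintro ⟨n, hn⟩
      obtain ⟨x, _, hx⟩ := Option.bind_eq_some_iff.1 hn
      split_ifs at hx with h
      cases hx
      exact sound p n w h
  exact ⟨_, causal_blockSeq hstage, fun p => listed p ▸ enumerates_blockSeq _⟩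

end SemiDec

/-! ### Listings -/

/-- The condition on the set `S` of triples enumerated by the second half of a `Δ`-name of `X`. -/
structure EffSpace.IsInterRel (X : EffSpace.{u} k) (S : Set (Word k × Word k × Word k)) :
    Prop where
  mem_dom : ∀ a ∈ S, a.1 ∈ X.dom ∧ a.2.1 ∈ X.dom ∧ a.2.2 ∈ X.dom
  inter_eq : ∀ u ∈ X.dom, ∀ v ∈ X.dom, X.nu u ∩ X.nu v = ⋃ w ∈ {w | (u, v, w) ∈ S}, X.nu w

/-- The sets enumerated by a `κ^Δ`-name, freed from their codings: the domain of the base notation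
and its complement, an intersection relation, and the finite covers. -/
structure Listing (k : ℕ) where
  dom : Set (Word k)
  compl : Set (Word k)
  inter : Set (Word k × Word k × Word k)
  covers : Set (Word k)

/-- `d` consists of the sets that a `κ^Δ`-name of `A` enumerates. -/
structure Listing.Describes (d : Listing k) (A : CompactPair.{u} k) : Prop where
  dom_eq : d.dom = A.space.dom
  compl_eq : d.compl = A.space.domᶜ
  inter : A.space.IsInterRel d.inter
  covers_eq : d.covers = A.space.finCovers A.set

/-- The listing read off a sequence `⟨⟨r₁,r₂⟩,s⟩` in the way a `κ^Δ`-name is read. -/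
def Listing.ofName (q : Seq k) : Listing k where
  dom := {v | InSeq (tuple [v, [1]]) (evens (evens q))}
  compl := {v | InSeq (tuple [v, [0]]) (evens (evens q))}
  inter := {a | InSeq (tuple [a.1, a.2.1, a.2.2]) (odds (evens q))}
  covers := {w | InSeq w (odds q)}

theorem EffSpace.tuple_one_mem_charGraph {X : EffSpace.{u} k} {v : Word k} :
    tuple [v, [1]] ∈ X.charGraph ↔ v ∈ X.dom := by
  simp [EffSpace.charGraph, tuple_injective.eq_iff]

theorem EffSpace.tuple_zero_mem_charGraph {X : EffSpace.{u} k} {v : Word k} :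
    tuple [v, [0]] ∈ X.charGraph ↔ v ∉ X.dom := by
  simp [EffSpace.charGraph, tuple_injective.eq_iff]

/-- The words `⟨u,v,w⟩` with `(u,v,w) ∈ S`. -/
def tripleWords (S : Set (Word k × Word k × Word k)) : Set (Word k) :=
  (fun a => tuple [a.1, a.2.1, a.2.2]) '' S

theorem tuple_mem_tripleWords {S : Set (Word k × Word k × Word k)} {a : Word k × Word k × Word k} :
    tuple [a.1, a.2.1, a.2.2] ∈ tripleWords S ↔ a ∈ S := by
  have tuple_inj : Function.Injective fun a : Word k × Word k × Word k =>
      tuple [a.1, a.2.1, a.2.2] := fun a b h => by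
    simpa [Prod.ext_iff] using tuple_injective h
  exact tuple_inj.mem_set_image

theorem Listing.describes_ofName {q : Seq k} {A : CompactPair.{u} k} (h : kappaDelta q A) :
    (Listing.ofName q).Describes A := by
  obtain ⟨_, s, rfl, ⟨r₁, r₂, rfl, hgraph, S, hS, htriples, hinter⟩, hcovers⟩ := h
  have inter_eq : (ofName (seqPair (seqPair r₁ r₂) s)).inter = S := by
    ext a
    simp only [ofName, evens_seqPair, odds_seqPair, Set.mem_ofPred_eq]
    exact (htriples _).trans tuple_mem_tripleWords
  refine ⟨?_, ?_, inter_eq ▸ ⟨hS, hinter⟩, ?_⟩ <;> ext v <;>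
    simp only [ofName, evens_seqPair, odds_seqPair, Set.mem_ofPred_eq]
  · exact (hgraph _).trans EffSpace.tuple_one_mem_charGraph
  · exact (hgraph _).trans EffSpace.tuple_zero_mem_charGraph
  · exact hcovers v

/-- The graph of the characteristic function of the domain, given by the two halves of a listing. -/
def Listing.graph (d : Listing k) : Set (Word k) :=
  {w | ∃ u, (u ∈ d.dom ∧ w = tuple [u, [1]]) ∨ (u ∈ d.compl ∧ w = tuple [u, [0]])}

theorem Listing.Describes.kappaDelta {d : Listing k} {A : CompactPair.{u} k} (h : d.Describes A)
    {r₁ r₂ s : Seq k} (hr₁ : Enumerates r₁ d.graph) (hr₂ : Enumerates r₂ (tripleWords d.inter))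
    (hs : Enumerates s d.covers) : kappaDelta (seqPair (seqPair r₁ r₂) s) A := by
  have graph_eq : d.graph = A.space.charGraph := by
    simp only [Listing.graph, h.dom_eq, h.compl_eq, EffSpace.charGraph, Set.mem_compl_iff]
  exact ⟨_, s, rfl, ⟨r₁, r₂, rfl, graph_eq ▸ hr₁, d.inter, h.inter.mem_dom, hr₂,
    h.inter.inter_eq⟩, h.covers_eq ▸ hs⟩

/-- The four components of the listings `d p a` are semidecidable relative to `p`, uniformly in the
parameter `a`. -/
structure Listing.IsSemiDec {α : Type*} [Primcodable α] (d : Seq k → α → Listing k) : Prop where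
  dom : SemiDec fun p (x : α × Word k) => x.2 ∈ (d p x.1).dom
  compl : SemiDec fun p (x : α × Word k) => x.2 ∈ (d p x.1).compl
  inter : SemiDec fun p (x : α × Word k × Word k × Word k) => x.2 ∈ (d p x.1).inter
  covers : SemiDec fun p (x : α × Word k) => x.2 ∈ (d p x.1).covers

section Parameter

variable {α : Type*} [Primcodable α]

theorem Listing.isSemiDec_ofName {pos : α → ℕ → ℕ} (hpos : Primrec₂ pos) :
    IsSemiDec fun (p : Seq k) a => ofName fun j => p (pos a j) := by
  have hshift : ∀ {β : Type} [Primcodable β] {g : ℕ → ℕ}, Primrec g →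
      Primrec₂ fun (x : α × β) j => pos x.1 (g j) := fun hg =>
    hpos.comp (Primrec.fst.comp .fst) (hg.comp .snd)
  exact
    { dom := .inSeq (hshift (nat_double.comp nat_double)) ((primrec_tuple_pair [1]).comp .snd)
      compl := .inSeq (hshift (nat_double.comp nat_double)) ((primrec_tuple_pair [0]).comp .snd)
      inter := .inSeq (hshift (nat_double.comp nat_double_succ)) (primrec_tuple_triple.comp .snd)
      covers := .inSeq (hshift nat_double_succ) .snd }

theorem SemiDec.exists_enumeration_of_unique {format : Seq k → α → Prop}
    {E : Seq k → α → Set (Word k)} (hformat : SemiDec format)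
    (hE : SemiDec fun p (x : α × Word k) => x.2 ∈ E p x.1) :
    ∃ F : Seq k → Seq k, Causal F ∧
      ∀ p a, (∀ b, format p b ↔ b = a) → Enumerates (F p) (E p a) := by
  have hex : SemiDec fun p w => ∃ a, format p a ∧ w ∈ E p a :=
    exists_of_prod (φ := fun p w a => format p a ∧ w ∈ E p a)
      ((hformat.comp .snd).and (hE.comp (Primrec.pair .snd .fst)))
  obtain ⟨F, hF, enumerates⟩ := hex.exists_enumeration
  refine ⟨F, hF, fun p a ha => ?_⟩
  simpa only [ha, exists_eq_left, Set.ofPred_mem_eq] using enumerates p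

namespace Listing.IsSemiDec

variable {d : Seq k → α → Listing k}

theorem graph (hd : IsSemiDec d) : SemiDec fun p (x : α × Word k) => x.2 ∈ (d p x.1).graph := by
  have hcode : ∀ c : Word k, PrimrecPred fun y : (α × Word k) × Word k =>
      y.1.2 = tuple [y.2, c] := fun c =>
    Primrec.eq.comp (Primrec.snd.comp .fst) ((primrec_tuple_pair c).comp .snd)
  have harg : Primrec fun y : (α × Word k) × Word k => (y.1.1, y.2) :=
    Primrec.pair (Primrec.fst.comp .fst) .snd
  exact SemiDec.exists_of_prod (φ := fun p (x : α × Word k) u =>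
    (u ∈ (d p x.1).dom ∧ x.2 = tuple [u, [1]]) ∨ (u ∈ (d p x.1).compl ∧ x.2 = tuple [u, [0]]))
    (((hd.dom.comp harg).and (.of_primrec (hcode [1]))).or
      ((hd.compl.comp harg).and (.of_primrec (hcode [0]))))

theorem tripleWords (hd : IsSemiDec d) :
    SemiDec fun p (x : α × Word k) => x.2 ∈ tripleWords (d p x.1).inter := by
  have hcode : PrimrecPred fun y : (α × Word k) × Word k × Word k × Word k =>
      tuple [y.2.1, y.2.2.1, y.2.2.2] = y.1.2 :=
    Primrec.eq.comp (primrec_tuple_triple.comp .snd) (Primrec.snd.comp .fst)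
  exact SemiDec.exists_of_prod (φ := fun p (x : α × Word k) a =>
    a ∈ (d p x.1).inter ∧ tuple [a.1, a.2.1, a.2.2] = x.2)
    ((hd.inter.comp (Primrec.pair (Primrec.fst.comp .fst) .snd)).and (.of_primrec hcode))

end Listing.IsSemiDec

/-- The relation `format` reads off the input a discrete parameter `a`, such as the number of
factors, on which the listing of the value depends. -/
theorem repComputable_kappaDelta {M : Type v} {γ : MultiRep k M} {f : M → CompactPair.{u} k}
    {format : Seq k → α → Prop} {d : Seq k → α → Listing k} (hformat : SemiDec format)
    (hd : Listing.IsSemiDec d)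
    (describes : ∀ p x, γ p x → ∃ a, (∀ b, format p b ↔ b = a) ∧ (d p a).Describes (f x)) :
    RepComputable γ kappaDelta f := by
  obtain ⟨F₁, causal₁, enum₁⟩ :=
    hformat.exists_enumeration_of_unique (E := fun p a => (d p a).graph) hd.graph
  obtain ⟨F₂, causal₂, enum₂⟩ :=
    hformat.exists_enumeration_of_unique (E := fun p a => tripleWords (d p a).inter) hd.tripleWords
  obtain ⟨F₃, causal₃, enum₃⟩ :=
    hformat.exists_enumeration_of_unique (E := fun p a => (d p a).covers) hd.covers
  refine ⟨_, ((causal₁.seqPair causal₂).seqPair causal₃).computableSeqFun, fun p x hpx => ?_⟩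
  obtain ⟨a, ha, hdescr⟩ := describes p x hpx
  exact ⟨_, Part.mem_some _, hdescr.kappaDelta (enum₁ p a ha) (enum₂ p a ha) (enum₃ p a ha)⟩

end Parameter

/-! ### Choosing one side of every box -/

theorem exists_forall_mem_iff_sections {α : Type*} {L : List (List α)} {P : α → Prop} :
    (∃ l ∈ L, ∀ y ∈ l, P y) ↔ ∀ c ∈ L.sections, ∃ y ∈ c, P y := by
  induction L with
  | nil => simp [List.sections]
  | cons l L ih =>
    simp only [List.exists_mem_cons_iff, ih, List.sections, List.mem_flatMap, List.mem_map,
      forall_exists_index, and_imp]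
    constructor
    · rintro h _ s hs a ha rfl
      exact List.exists_mem_cons_iff _ _ _ |>.2 (h.imp (· a ha) (· s hs))
    · intro h
      by_contra! hne
      obtain ⟨⟨a, ha, hPa⟩, s, hs, hPs⟩ := hne
      obtain ⟨y, hy, hPy⟩ := h _ s hs a ha rfl
      rcases List.mem_cons.1 hy with rfl | hy
      · exact hPa hPy
      · exact hPs y hy hPy

theorem exists_mem_of_mem_sections {α : Type*} {L : List (List α)} {c : List α} {y : α}
    (hc : c ∈ L.sections) (hy : y ∈ c) : ∃ l ∈ L, y ∈ l := by
  rw [List.mem_sections] at hc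
  induction hc with
  | nil => exact absurd hy List.not_mem_nil
  | cons ha _ ih =>
    rcases List.mem_cons.1 hy with rfl | hy
    · exact ⟨_, List.mem_cons_self, ha⟩
    · obtain ⟨l, hl, hyl⟩ := ih hy
      exact ⟨l, List.mem_cons_of_mem _ hl, hyl⟩

theorem univ_pi_subset_iUnion_preimage_eval {ι : Type*} {α : ι → Type*} {K U : ∀ i, Set (α i)} :
    Set.univ.pi K ⊆ ⋃ i, Function.eval i ⁻¹' U i ↔ ∃ i, K i ⊆ U i := by
  constructor
  · intro h
    by_contra! hK
    choose x hxK hxU using fun i => Set.not_subset.1 (hK i)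
    obtain ⟨i, hi⟩ := Set.mem_iUnion.1 (h fun i _ => hxK i)
    exact hxU i hi
  · rintro ⟨i, hi⟩ x hx
    exact Set.mem_iUnion.2 ⟨i, hi (hx i trivial)⟩

/-- The words `v` for which `(v, j)` belongs to the list `c`. -/
def select (c : List (Word k × ℕ)) (j : ℕ) : List (Word k) :=
  c.filterMap fun y => if y.2 = j then some y.1 else none

theorem mem_select {c : List (Word k × ℕ)} {j : ℕ} {v : Word k} : v ∈ select c j ↔ (v, j) ∈ c := by
  simp [select]

/-! ### Products of listings -/

theorem EffSpace.mem_finCovers_iff {X : EffSpace.{u} k} {K : Set X} {w : Word k} :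
    w ∈ X.finCovers K ↔ (∀ v ∈ parts w, v ∈ X.dom) ∧ K ⊆ ⋃ v ∈ parts w, X.nu v := by
  simp only [EffSpace.finCovers, mem_parts, Set.mem_ofPred_eq]

/-- A coding of the boxes of a product over the index type `Index`, embedded into `ℕ` by `index`.
A box is given by the list of its sides, the `j`-th entry belonging to the factor with number `j`;
the factors beyond the length of the list are unrestricted. The admissible lengths are those with
`arity`, the function `code` codes lists of sides as words, and `sides` decodes them. -/
structure BoxCoding (k : ℕ) where
  Index : Type
  index : Index ↪ ℕ
  arity : ℕ → Prop
  code : List (Word k) → Word k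
  sides : Word k → List (Word k)
  mem_range_index : ∀ {m j}, arity m → j < m → j ∈ Set.range index
  sides_code : ∀ {l}, arity l.length → sides (code l) = l

/-- The coordinates `o₁, o₂, o₃` of three boxes are related as required for an intersection
relation: by the relation `S` of the factor, or trivially if a coordinate is unrestricted, which is
expressed by `none`. -/
def MeetOption (S : Set (Word k × Word k × Word k))
    (o : Option (Word k) × Option (Word k) × Option (Word k)) : Prop :=
  (∃ a ∈ S, o = (some a.1, some a.2.1, some a.2.2)) ∨ (o.2.1 = none ∧ o.2.2 = o.1) ∨
    (o.1 = none ∧ o.2.2 = o.2.1)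

section MeetOption

variable {X : EffSpace.{u} k} {S : Set (Word k × Word k × Word k)}
  {o₁ o₂ o₃ : Option (Word k)} {x : X}

theorem MeetOption.isSome_iff (h : MeetOption S (o₁, o₂, o₃)) :
    o₃.isSome ↔ o₁.isSome ∨ o₂.isSome := by
  obtain ⟨a, _, h⟩ | ⟨h₂, h₃⟩ | ⟨h₁, h₃⟩ := h <;> simp_all

theorem MeetOption.mem_nu (hS : X.IsInterRel S) (h : MeetOption S (o₁, o₂, o₃))
    (hx : ∀ w ∈ o₃, x ∈ X.nu w) : (∀ u ∈ o₁, x ∈ X.nu u) ∧ ∀ v ∈ o₂, x ∈ X.nu v := by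
  obtain ⟨⟨u, v, w⟩, ha, ho⟩ | ⟨h₂, h₃⟩ | ⟨h₁, h₃⟩ := h
  · obtain ⟨rfl, rfl, rfl⟩ : o₁ = some u ∧ o₂ = some v ∧ o₃ = some w := by simpa using ho
    obtain ⟨hu, hv, _⟩ := hS.mem_dom _ ha
    have : x ∈ X.nu u ∩ X.nu v := by
      rw [hS.inter_eq u hu v hv]
      exact Set.mem_biUnion ha (hx w rfl)
    simpa using this
  · obtain rfl : o₂ = none := h₂
    obtain rfl : o₃ = o₁ := h₃
    exact ⟨hx, by simp⟩
  · obtain rfl : o₁ = none := h₁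
    obtain rfl : o₃ = o₂ := h₃
    exact ⟨by simp, hx⟩

theorem exists_meetOption (hS : X.IsInterRel S) (hx₁ : ∀ u ∈ o₁, x ∈ X.nu u)
    (hx₂ : ∀ v ∈ o₂, x ∈ X.nu v) : ∃ o₃, MeetOption S (o₁, o₂, o₃) ∧ ∀ w ∈ o₃, x ∈ X.nu w := by
  rcases o₁ with _ | u
  · exact ⟨o₂, .inr (.inr ⟨rfl, rfl⟩), hx₂⟩
  rcases o₂ with _ | v
  · exact ⟨some u, .inr (.inl ⟨rfl, rfl⟩), hx₁⟩
  have hu := hx₁ u rfl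
  have hv := hx₂ v rfl
  have meet : x ∈ X.nu u ∩ X.nu v := ⟨hu, hv⟩
  rw [hS.inter_eq u (X.mem_dom hu) v (X.mem_dom hv), Set.mem_iUnion₂] at meet
  obtain ⟨w, hw, hxw⟩ := meet
  exact ⟨some w, .inl ⟨_, hw, rfl⟩, by simpa using hxw⟩

end MeetOption

theorem exists_list_getElem?_eq {α : Type*} {o : ℕ → Option α} {n : ℕ}
    (h : ∀ j, (o j).isSome ↔ j < n) : ∃ l : List α, l.length = n ∧ ∀ j, l[j]? = o j := by
  refine ⟨List.ofFn fun j : Fin n => (o j).get ((h j).2 j.2), List.length_ofFn, fun j => ?_⟩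
  rw [List.getElem?_ofFn]
  split_ifs with hj
  · exact Option.some_get _
  · exact (Option.not_isSome_iff_eq_none.1 (mt (h j).1 hj)).symm

namespace BoxCoding

/-- The words that code a list of sides of admissible length. -/
def IsCode (C : BoxCoding k) (w : Word k) : Prop :=
  C.arity (C.sides w).length ∧ C.code (C.sides w) = w

/-- The listing of a product, obtained from the listings of the factors. For the covers, one chooses
a side of every box in all possible ways; by distributivity, the boxes cover a product of sets if
and only if for each choice the chosen sides in some factor cover the set in this factor. -/
def listing (C : BoxCoding k) (d : ℕ → Listing k) : Listing k :=
  let dom : Set (Word k) := {w | C.IsCode w ∧ ∀ y ∈ (C.sides w).zipIdx, y.1 ∈ (d y.2).dom}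
  { dom := dom
    compl := {w | ¬ C.IsCode w ∨ ∃ y ∈ (C.sides w).zipIdx, y.1 ∈ (d y.2).compl}
    inter := {a | (a.1 ∈ dom ∧ a.2.1 ∈ dom ∧ a.2.2 ∈ dom) ∧ ∀ j, MeetOption (d j).inter
      ((C.sides a.1)[j]?, (C.sides a.2.1)[j]?, (C.sides a.2.2)[j]?)}
    covers := {w | (∀ v ∈ parts w, v ∈ dom) ∧
      ∀ c ∈ ((parts w).map fun v => (C.sides v).zipIdx).sections,
        ∃ j, j ∈ Set.range C.index ∧ tuple (select c j) ∈ (d j).covers} }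

/-- The pair `Z` is the product of the pairs `B i`, with the boxes coded by `C`. The points of `Z`
are given by families of points through the surjection `point`. -/
structure Presentation (C : BoxCoding k) (B : C.Index → CompactPair.{u} k)
    (Z : CompactPair.{u} k) where
  point : (∀ i, (B i).space) → Z.space
  surjective_point : Function.Surjective point
  mem_dom_iff : ∀ {w}, w ∈ Z.space.dom ↔ ∃ l, C.arity l.length ∧
    (∀ i, ∀ v ∈ l[C.index i]?, v ∈ (B i).space.dom) ∧ C.code l = w
  point_mem_nu_code_iff : ∀ {x l}, C.arity l.length →
    (point x ∈ Z.space.nu (C.code l) ↔ ∀ i, ∀ v ∈ l[C.index i]?, x i ∈ (B i).space.nu v)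
  point_mem_set_iff : ∀ {x}, point x ∈ Z.set ↔ ∀ i, x i ∈ (B i).set

variable {C : BoxCoding k} {B : C.Index → CompactPair.{u} k} {Z : CompactPair.{u} k}
  {d : ℕ → Listing k}

theorem isCode_and_iff {w : Word k} {Q : List (Word k) → Prop} :
    C.IsCode w ∧ Q (C.sides w) ↔ ∃ l, C.arity l.length ∧ Q l ∧ C.code l = w := by
  constructor
  · rintro ⟨⟨hlen, hcode⟩, hQ⟩
    exact ⟨_, hlen, hQ, hcode⟩
  · rintro ⟨l, hlen, hQ, rfl⟩
    rw [IsCode, C.sides_code hlen]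
    exact ⟨⟨hlen, rfl⟩, hQ⟩

theorem mem_range_index_of_mem_zipIdx {l : List (Word k)} (hl : C.arity l.length)
    {y : Word k × ℕ} (hy : y ∈ l.zipIdx) : ∃ i, C.index i = y.2 :=
  C.mem_range_index hl (List.snd_lt_of_mem_zipIdx hy)

theorem forall_mem_zipIdx_iff {l : List (Word k)} (hl : C.arity l.length)
    {R : Word k × ℕ → Prop} :
    (∀ y ∈ l.zipIdx, R y) ↔ ∀ i, ∀ v ∈ l[C.index i]?, R (v, C.index i) := by
  constructor
  · exact fun h i v hv => h _ (List.mk_mem_zipIdx_iff_getElem?.2 hv)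
  · rintro h ⟨v, j⟩ hy
    obtain ⟨i, rfl⟩ := mem_range_index_of_mem_zipIdx hl hy
    exact h i v (List.mk_mem_zipIdx_iff_getElem?.1 hy)

/-- The points whose coordinate number `y.2` belongs to the base set coded by `y.1`. -/
def slab (C : BoxCoding k) (B : C.Index → CompactPair.{u} k) (y : Word k × ℕ) :
    Set (∀ i, (B i).space) :=
  {x | ∃ i, C.index i = y.2 ∧ x i ∈ (B i).space.nu y.1}

theorem mem_slab_index {x : ∀ i, (B i).space} {v : Word k} {i : C.Index} :
    x ∈ C.slab B (v, C.index i) ↔ x i ∈ (B i).space.nu v := by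
  simp [slab]

theorem exists_mem_slab_iff {x : ∀ i, (B i).space} {c : List (Word k × ℕ)} :
    (∃ y ∈ c, x ∈ C.slab B y) ↔
      x ∈ ⋃ i, Function.eval i ⁻¹' ⋃ v ∈ select c (C.index i), (B i).space.nu v := by
  simp only [Set.mem_iUnion, Set.mem_preimage, mem_select, exists_prop, Function.eval]
  constructor
  · rintro ⟨⟨v, _⟩, hy, i, rfl, hx⟩
    exact ⟨i, v, hy, hx⟩
  · rintro ⟨i, v, hy, hx⟩
    exact ⟨_, hy, mem_slab_index.2 hx⟩

theorem exists_meet (hd : ∀ i, (d (C.index i)).Describes (B i)) {x : ∀ i, (B i).space}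
    {l₁ l₂ : List (Word k)} (len₁ : C.arity l₁.length) (len₂ : C.arity l₂.length)
    (hx₁ : ∀ i, ∀ u ∈ l₁[C.index i]?, x i ∈ (B i).space.nu u)
    (hx₂ : ∀ i, ∀ v ∈ l₂[C.index i]?, x i ∈ (B i).space.nu v) :
    ∃ l₃ : List (Word k), C.arity l₃.length ∧
      (∀ j, MeetOption (d j).inter (l₁[j]?, l₂[j]?, l₃[j]?)) ∧
      ∀ i, ∀ w ∈ l₃[C.index i]?, x i ∈ (B i).space.nu w := by
  have side : ∀ j, ∃ o, MeetOption (d j).inter (l₁[j]?, l₂[j]?, o) ∧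
      ∀ i, C.index i = j → ∀ w ∈ o, x i ∈ (B i).space.nu w := fun j => by
    by_cases hj : j ∈ Set.range C.index
    · obtain ⟨i, rfl⟩ := hj
      obtain ⟨o, ho, hxo⟩ := exists_meetOption (hd i).inter (hx₁ i) (hx₂ i)
      refine ⟨o, ho, fun i' hi' => ?_⟩
      obtain rfl := C.index.injective hi'
      exact hxo
    · have outside : ∀ {l : List (Word k)}, C.arity l.length → l[j]? = none := fun hl =>
        List.getElem?_eq_none (le_of_not_gt fun hlt => hj (C.mem_range_index hl hlt))
      rw [outside len₁, outside len₂]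
      exact ⟨none, .inr (.inl ⟨rfl, rfl⟩), fun i hi => absurd ⟨i, hi⟩ hj⟩
  choose o ho hxo using side
  obtain ⟨l₃, len₃, hl₃⟩ : ∃ l₃ : List (Word k), l₃.length = max l₁.length l₂.length ∧
      ∀ j, l₃[j]? = o j := exists_list_getElem?_eq fun j => by
    simp only [(ho j).isSome_iff, isSome_getElem?, lt_max_iff]
  refine ⟨l₃, ?_, fun j => hl₃ j ▸ ho j, fun i => hl₃ _ ▸ hxo _ i rfl⟩
  rcases max_choice l₁.length l₂.length with h | h <;> rwa [len₃, h]

namespace Presentation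

variable (P : C.Presentation B Z)
include P

theorem point_mem_nu_iff {x : ∀ i, (B i).space} {w : Word k} (hw : w ∈ Z.space.dom) :
    P.point x ∈ Z.space.nu w ↔ ∀ y ∈ (C.sides w).zipIdx, x ∈ C.slab B y := by
  obtain ⟨l, hl, _, rfl⟩ := P.mem_dom_iff.1 hw
  simp only [P.point_mem_nu_code_iff hl, C.sides_code hl,
    forall_mem_zipIdx_iff (R := fun y => x ∈ C.slab B y) hl, mem_slab_index]

theorem set_subset_iUnion_nu_iff {l : List (Word k)} (hl : ∀ w ∈ l, w ∈ Z.space.dom) :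
    Z.set ⊆ ⋃ w ∈ l, Z.space.nu w ↔ ∀ c ∈ (l.map fun w => (C.sides w).zipIdx).sections,
      ∃ i, (B i).set ⊆ ⋃ v ∈ select c (C.index i), (B i).space.nu v := by
  have mem_iff : ∀ x, P.point x ∈ ⋃ w ∈ l, Z.space.nu w ↔
      ∀ c ∈ (l.map fun w => (C.sides w).zipIdx).sections, ∃ y ∈ c, x ∈ C.slab B y := fun x => by
    simp only [← exists_forall_mem_iff_sections (P := fun y => x ∈ C.slab B y), List.mem_map,
      exists_exists_and_eq_and, Set.mem_iUnion₂, exists_prop]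
    exact exists_congr fun w => and_congr_right fun hw => P.point_mem_nu_iff (hl w hw)
  calc Z.set ⊆ ⋃ w ∈ l, Z.space.nu w
      ↔ ∀ x ∈ Set.univ.pi fun i => (B i).set,
          ∀ c ∈ (l.map fun w => (C.sides w).zipIdx).sections, ∃ y ∈ c, x ∈ C.slab B y := by
        rw [Set.subset_def, P.surjective_point.forall]
        simp only [P.point_mem_set_iff, mem_iff, Set.mem_univ_pi]
    _ ↔ ∀ c ∈ (l.map fun w => (C.sides w).zipIdx).sections,
          Set.univ.pi (fun i => (B i).set) ⊆
            ⋃ i, Function.eval i ⁻¹' ⋃ v ∈ select c (C.index i), (B i).space.nu v := by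
        simp only [exists_mem_slab_iff, Set.subset_def]
        exact ⟨fun h c hc x hx => h x hx c hc, fun h x hx c hc => h c hc x hx⟩
    _ ↔ _ := by simp only [univ_pi_subset_iUnion_preimage_eval]

variable (hd : ∀ i, (d (C.index i)).Describes (B i))
include hd

theorem dom_listing : (C.listing d).dom = Z.space.dom := by
  ext w
  rw [P.mem_dom_iff]
  refine (isCode_and_iff (Q := fun l => ∀ y ∈ l.zipIdx, y.1 ∈ (d y.2).dom)).trans ?_
  refine exists_congr fun l => and_congr_right fun hl => and_congr_left fun _ => ?_
  simp only [forall_mem_zipIdx_iff (R := fun y => y.1 ∈ (d y.2).dom) hl, (hd _).dom_eq]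

theorem compl_listing : (C.listing d).compl = Z.space.domᶜ := by
  ext w
  rw [← P.dom_listing hd, Set.mem_compl_iff]
  simp only [listing, Set.mem_ofPred_eq, not_and_or, not_forall, exists_prop]
  by_cases hw : C.IsCode w
  · refine or_congr_right (exists_congr fun y => and_congr_right fun hy => ?_)
    obtain ⟨i, hi⟩ := mem_range_index_of_mem_zipIdx hw.1 hy
    rw [← hi, (hd i).compl_eq, (hd i).dom_eq, Set.mem_compl_iff]
  · exact iff_of_true (.inl hw) (.inl hw)

theorem mem_inter_listing {a : Word k × Word k × Word k} :
    a ∈ (C.listing d).inter ↔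
      (a.1 ∈ Z.space.dom ∧ a.2.1 ∈ Z.space.dom ∧ a.2.2 ∈ Z.space.dom) ∧
        ∀ j, MeetOption (d j).inter
          ((C.sides a.1)[j]?, (C.sides a.2.1)[j]?, (C.sides a.2.2)[j]?) := by
  rw [← P.dom_listing hd]
  exact Iff.rfl

theorem isInterRel_listing : Z.space.IsInterRel (C.listing d).inter where
  mem_dom _ ha := ((P.mem_inter_listing hd).1 ha).1
  inter_eq u hu v hv := by
    obtain ⟨l₁, len₁, _, rfl⟩ := P.mem_dom_iff.1 hu
    obtain ⟨l₂, len₂, _, rfl⟩ := P.mem_dom_iff.1 hv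
    ext z
    obtain ⟨x, rfl⟩ := P.surjective_point z
    simp only [Set.mem_inter_iff, Set.mem_iUnion₂, Set.mem_ofPred_eq, exists_prop,
      P.mem_inter_listing hd]
    constructor
    · rintro ⟨h₁, h₂⟩
      obtain ⟨l₃, len₃, meet, hx₃⟩ := exists_meet hd len₁ len₂
        ((P.point_mem_nu_code_iff len₁).1 h₁) ((P.point_mem_nu_code_iff len₂).1 h₂)
      have mem_nu := (P.point_mem_nu_code_iff len₃).2 hx₃
      refine ⟨C.code l₃, ⟨⟨hu, hv, Z.space.mem_dom mem_nu⟩, ?_⟩, mem_nu⟩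
      simpa only [C.sides_code, len₁, len₂, len₃] using meet
    · rintro ⟨w, ⟨⟨_, _, hw⟩, meet⟩, hx⟩
      obtain ⟨l₃, len₃, _, rfl⟩ := P.mem_dom_iff.1 hw
      simp only [C.sides_code, len₁, len₂, len₃] at meet
      simp only [P.point_mem_nu_code_iff, len₁, len₂, len₃] at hx ⊢
      have hx' := fun i => (meet (C.index i)).mem_nu (hd i).inter (hx i)
      exact ⟨fun i => (hx' i).1, fun i => (hx' i).2⟩

theorem mem_dom_of_mem_select {L : List (Word k)} (hL : ∀ w ∈ L, w ∈ Z.space.dom)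
    {c : List (Word k × ℕ)} (hc : c ∈ (L.map fun w => (C.sides w).zipIdx).sections)
    {i : C.Index} {v : Word k} (hv : v ∈ select c (C.index i)) : v ∈ (B i).space.dom := by
  obtain ⟨_, hl, hvl⟩ := exists_mem_of_mem_sections hc (mem_select.1 hv)
  obtain ⟨w, hw, rfl⟩ := List.mem_map.1 hl
  have sides_dom := (P.dom_listing hd).symm ▸ hL w hw
  exact (hd i).dom_eq ▸ sides_dom.2 _ hvl

theorem covers_listing : (C.listing d).covers = Z.space.finCovers Z.set := by
  ext w
  rw [EffSpace.mem_finCovers_iff, ← P.dom_listing hd]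
  refine and_congr_right fun hw => ?_
  replace hw : ∀ v ∈ parts w, v ∈ Z.space.dom := P.dom_listing hd ▸ hw
  rw [P.set_subset_iUnion_nu_iff hw]
  refine forall₂_congr fun c hc => Set.exists_range_iff.trans (exists_congr fun i => ?_)
  rw [(hd i).covers_eq, EffSpace.mem_finCovers_iff, parts_tuple]
  exact and_iff_right fun v hv => P.mem_dom_of_mem_select hd hw hc hv

theorem describes_listing : (C.listing d).Describes Z :=
  ⟨P.dom_listing hd, P.compl_listing hd, P.isInterRel_listing hd, P.covers_listing hd⟩

end Presentation

end BoxCoding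

/-! ### Computing products of listings -/

theorem primrec_select : Primrec₂ (select : List (Word k × ℕ) → ℕ → List (Word k)) :=
  listFilterMap .fst (Primrec.ite
    (Primrec.eq.comp (Primrec.snd.comp .snd) (Primrec.snd.comp .fst))
    (option_some.comp (Primrec.fst.comp .snd)) (.const none)).to₂

theorem SemiDec.meetOption {α : Type*} [Primcodable α]
    {S : Seq k → α → Set (Word k × Word k × Word k)}
    {o : α → Option (Word k) × Option (Word k) × Option (Word k)}
    (hS : SemiDec fun p (x : α × Word k × Word k × Word k) => x.2 ∈ S p x.1) (ho : Primrec o) :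
    SemiDec fun p a => MeetOption (S p a) (o a) := by
  have h₁ : Primrec fun a => (o a).1 := Primrec.fst.comp ho
  have h₂ : Primrec fun a => (o a).2.1 := Primrec.fst.comp (Primrec.snd.comp ho)
  have h₃ : Primrec fun a => (o a).2.2 := Primrec.snd.comp (Primrec.snd.comp ho)
  have triple : PrimrecPred fun x : α × Word k × Word k × Word k =>
      o x.1 = (some x.2.1, some x.2.2.1, some x.2.2.2) :=
    Primrec.eq.comp (ho.comp .fst) (Primrec.pair (option_some.comp (Primrec.fst.comp .snd))
      (Primrec.pair (option_some.comp (Primrec.fst.comp (Primrec.snd.comp .snd)))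
        (option_some.comp (Primrec.snd.comp (Primrec.snd.comp .snd)))))
  have meet : SemiDec fun p a => ∃ x ∈ S p a, o a = (some x.1, some x.2.1, some x.2.2) :=
    exists_of_prod (φ := fun p a x => x ∈ S p a ∧ o a = (some x.1, some x.2.1, some x.2.2))
      (hS.and (.of_primrec triple))
  exact meet.or ((of_primrec ((Primrec.eq.comp h₂ (.const none)).and (Primrec.eq.comp h₃ h₁))).or
    (of_primrec ((Primrec.eq.comp h₁ (.const none)).and (Primrec.eq.comp h₃ h₂))))

theorem forall_meetOption_iff {S : ℕ → Set (Word k × Word k × Word k)}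
    {l₁ l₂ l₃ : List (Word k)} : (∀ j, MeetOption (S j) (l₁[j]?, l₂[j]?, l₃[j]?)) ↔
      ∀ j ∈ List.range (l₁.length + (l₂.length + l₃.length)),
        MeetOption (S j) (l₁[j]?, l₂[j]?, l₃[j]?) := by
  refine ⟨fun h j _ => h j, fun h j => ?_⟩
  by_cases hj : j < l₁.length + (l₂.length + l₃.length)
  · exact h j (List.mem_range.2 hj)
  · rw [List.getElem?_eq_none (l := l₁) (by omega), List.getElem?_eq_none (l := l₂) (by omega),
      List.getElem?_eq_none (l := l₃) (by omega)]
    exact .inr (.inl ⟨rfl, rfl⟩)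

theorem SemiDec.forall_meetOption {α : Type*} [Primcodable α]
    {S : Seq k → α → ℕ → Set (Word k × Word k × Word k)} {l₁ l₂ l₃ : α → List (Word k)}
    (hS : SemiDec fun p (x : (α × ℕ) × Word k × Word k × Word k) => x.2 ∈ S p x.1.1 x.1.2)
    (h₁ : Primrec l₁) (h₂ : Primrec l₂) (h₃ : Primrec l₃) :
    SemiDec fun p a => ∀ j, MeetOption (S p a j) ((l₁ a)[j]?, (l₂ a)[j]?, (l₃ a)[j]?) := by
  have entry : ∀ {l : α → List (Word k)}, Primrec l → Primrec fun x : α × ℕ => (l x.1)[x.2]? :=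
    fun hl => list_getElem?.comp (hl.comp .fst) .snd
  exact (SemiDec.forall_mem (list_range.comp (nat_add.comp (list_length.comp h₁)
    (nat_add.comp (list_length.comp h₂) (list_length.comp h₃))))
    (φ := fun p a j => MeetOption (S p a j) ((l₁ a)[j]?, (l₂ a)[j]?, (l₃ a)[j]?))
    (.meetOption hS (Primrec.pair (entry h₁) (Primrec.pair (entry h₂) (entry h₃))))).of_iff
    fun _ _ => forall_meetOption_iff

namespace BoxCoding

/-- The codings `C n` are primitive recursive, uniformly in `n`. -/
structure IsPrimrec (C : ℕ → BoxCoding k) : Prop where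
  range : PrimrecRel fun n j => j ∈ Set.range (C n).index
  arity : PrimrecRel fun n => (C n).arity
  code : Primrec₂ fun n => (C n).code
  sides : Primrec₂ fun n => (C n).sides

namespace IsPrimrec

variable {C : ℕ → BoxCoding k} {d : Seq k → ℕ → ℕ → Listing k}

theorem isCode (hC : IsPrimrec C) : PrimrecRel fun n => (C n).IsCode :=
  PrimrecPred.and (hC.arity.comp .fst (list_length.comp hC.sides))
    (Primrec.eq.comp (hC.code.comp .fst hC.sides) .snd)

theorem dom (hC : IsPrimrec C) (hd : Listing.IsSemiDec fun p (a : ℕ × ℕ) => d p a.1 a.2) :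
    SemiDec fun p (x : ℕ × Word k) => x.2 ∈ ((C x.1).listing (d p x.1)).dom := by
  have sides_dom : SemiDec fun p (x : (ℕ × Word k) × Word k × ℕ) =>
      x.2.1 ∈ (d p x.1.1 x.2.2).dom :=
    hd.dom.comp (Primrec.pair (Primrec.pair (Primrec.fst.comp .fst) (Primrec.snd.comp .snd))
      (Primrec.fst.comp .snd))
  exact (SemiDec.of_primrec hC.isCode).and
    (sides_dom.forall_mem (φ := fun p x y => y.1 ∈ (d p x.1 y.2).dom)
      (primrec_zipIdx.comp hC.sides))

theorem compl (hC : IsPrimrec C) (hd : Listing.IsSemiDec fun p (a : ℕ × ℕ) => d p a.1 a.2) :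
    SemiDec fun p (x : ℕ × Word k) => x.2 ∈ ((C x.1).listing (d p x.1)).compl := by
  have sides_compl : SemiDec fun p (x : (ℕ × Word k) × Word k × ℕ) =>
      x.2.1 ∈ (d p x.1.1 x.2.2).compl :=
    hd.compl.comp (Primrec.pair (Primrec.pair (Primrec.fst.comp .fst) (Primrec.snd.comp .snd))
      (Primrec.fst.comp .snd))
  exact (SemiDec.of_primrec hC.isCode.not).or
    (sides_compl.exists_mem (φ := fun p x y => y.1 ∈ (d p x.1 y.2).compl)
      (primrec_zipIdx.comp hC.sides))

theorem inter (hC : IsPrimrec C) (hd : Listing.IsSemiDec fun p (a : ℕ × ℕ) => d p a.1 a.2) :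
    SemiDec fun p (x : ℕ × Word k × Word k × Word k) =>
      x.2 ∈ ((C x.1).listing (d p x.1)).inter := by
  have word₁ : Primrec fun x : ℕ × Word k × Word k × Word k => (x.1, x.2.1) :=
    Primrec.pair .fst (Primrec.fst.comp .snd)
  have word₂ : Primrec fun x : ℕ × Word k × Word k × Word k => (x.1, x.2.2.1) :=
    Primrec.pair .fst (Primrec.fst.comp (Primrec.snd.comp .snd))
  have word₃ : Primrec fun x : ℕ × Word k × Word k × Word k => (x.1, x.2.2.2) :=
    Primrec.pair .fst (Primrec.snd.comp (Primrec.snd.comp .snd))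
  have factor : SemiDec fun p (y : ((ℕ × Word k × Word k × Word k) × ℕ) ×
      Word k × Word k × Word k) => y.2 ∈ (d p y.1.1.1 y.1.2).inter :=
    hd.inter.comp (Primrec.pair (Primrec.pair (Primrec.fst.comp (Primrec.fst.comp .fst))
      (Primrec.snd.comp .fst)) .snd)
  have meets : SemiDec fun p (x : ℕ × Word k × Word k × Word k) => ∀ j,
      MeetOption (d p x.1 j).inter (((C x.1).sides x.2.1)[j]?, ((C x.1).sides x.2.2.1)[j]?,
        ((C x.1).sides x.2.2.2)[j]?) :=
    SemiDec.forall_meetOption factor (Primrec.comp hC.sides word₁) (Primrec.comp hC.sides word₂)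
      (Primrec.comp hC.sides word₃)
  have dom := hC.dom hd
  exact ((dom.comp word₁).and ((dom.comp word₂).and (dom.comp word₃))).and meets

theorem covers (hC : IsPrimrec C) (hd : Listing.IsSemiDec fun p (a : ℕ × ℕ) => d p a.1 a.2) :
    SemiDec fun p (x : ℕ × Word k) => x.2 ∈ ((C x.1).listing (d p x.1)).covers := by
  have parts_dom : SemiDec fun p (x : ℕ × Word k) =>
      ∀ v ∈ parts x.2, v ∈ ((C x.1).listing (d p x.1)).dom :=
    SemiDec.forall_mem (φ := fun p x v => v ∈ ((C x.1).listing (d p x.1)).dom)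
      (primrec_parts.comp .snd) ((hC.dom hd).comp (Primrec.pair (Primrec.fst.comp .fst) .snd))
  have choices : Primrec fun x : ℕ × Word k =>
      ((parts x.2).map fun v => ((C x.1).sides v).zipIdx).sections :=
    primrec_sections.comp (list_map (primrec_parts.comp .snd)
      (primrec_zipIdx.comp (hC.sides.comp (Primrec.fst.comp .fst) .snd)).to₂)
  have factor : SemiDec fun p (y : ((ℕ × Word k) × List (Word k × ℕ)) × ℕ) =>
      y.2 ∈ Set.range (C y.1.1.1).index ∧ tuple (select y.1.2 y.2) ∈ (d p y.1.1.1 y.2).covers := by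
    have hn : Primrec fun y : ((ℕ × Word k) × List (Word k × ℕ)) × ℕ => y.1.1.1 :=
      Primrec.fst.comp (Primrec.fst.comp .fst)
    exact (SemiDec.of_primrec (hC.range.comp hn .snd)).and
      (hd.covers.comp (Primrec.pair (Primrec.pair hn .snd)
        (primrec_tuple.comp (primrec_select.comp (Primrec.snd.comp .fst) .snd))))
  exact parts_dom.and (SemiDec.forall_mem choices
    (φ := fun p x c => ∃ j, j ∈ Set.range (C x.1).index ∧
      tuple (select c j) ∈ (d p x.1 j).covers)
    (SemiDec.exists_of_prod (φ := fun p (x : (ℕ × Word k) × List (Word k × ℕ)) j =>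
      j ∈ Set.range (C x.1.1).index ∧ tuple (select x.2 j) ∈ (d p x.1.1 j).covers) factor))

theorem listing (hC : IsPrimrec C) (hd : Listing.IsSemiDec fun p (a : ℕ × ℕ) => d p a.1 a.2) :
    Listing.IsSemiDec fun p n => (C n).listing (d p n) :=
  ⟨hC.dom hd, hC.compl hd, hC.inter hd, hC.covers hd⟩

end IsPrimrec

end BoxCoding

/-- The name of the factor with number `j` is read at the positions `pos (n, j) 0`,
`pos (n, j) 1`, … of the input, where `n` is the parameter determined by `format`. -/
theorem BoxCoding.IsPrimrec.repComputable {M : Type v} {γ : MultiRep k M}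
    {f : M → CompactPair.{u} k} {C : ℕ → BoxCoding k} (hC : IsPrimrec C) {format : Seq k → ℕ → Prop}
    (hformat : SemiDec format) {pos : ℕ × ℕ → ℕ → ℕ} (hpos : Primrec₂ pos)
    (factors : ∀ p x, γ p x → ∃ n, (∀ m, format p m ↔ m = n) ∧
      ∃ B : (C n).Index → CompactPair k,
        (∀ i, kappaDelta (fun j => p (pos (n, (C n).index i) j)) (B i)) ∧
          Nonempty ((C n).Presentation B (f x))) :
    RepComputable γ kappaDelta f := by
  refine repComputable_kappaDelta hformat (hC.listing
    (d := fun p n i => Listing.ofName fun j => p (pos (n, i) j)) (Listing.isSemiDec_ofName hpos))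
    fun p x hpx => ?_
  obtain ⟨n, hn, B, hB, ⟨P⟩⟩ := factors p x hpx
  exact ⟨n, hn, P.describes_listing fun i => Listing.describes_ofName (hB i)⟩

/-! ### Finite products -/

/-- The word `⟨…⟨⟨u₁,u₂⟩,u₃⟩…,uₙ⟩` that codes a box of a product bracketed to the left. -/
def nest : List (Word k) → Word k
  | [] => []
  | u :: l => l.foldl (fun w v => tuple [w, v]) u

theorem nest_concat {l : List (Word k)} (hl : l ≠ []) (v : Word k) :
    nest (l ++ [v]) = tuple [nest l, v] := by
  obtain ⟨u, l, rfl⟩ := List.exists_cons_of_ne_nil hl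
  exact List.foldl_append

/-- Splits the last component off a nested pair, and puts it in front of those found before. -/
def unnestStep (x : Word k × List (Word k)) : Word k × List (Word k) :=
  ((parts x.1).getD 0 [], (parts x.1).getD 1 [] :: x.2)

/-- The `n + 1` components of a nested pair with `n` levels. -/
def unnest (n : ℕ) (w : Word k) : List (Word k) :=
  let x := unnestStep^[n] (w, [])
  x.1 :: x.2

theorem iterate_unnestStep (u : Word k) (l acc : List (Word k)) :
    unnestStep^[l.length] (nest (u :: l), acc) = (u, l ++ acc) := by
  induction l using List.reverseRecOn generalizing acc with
  | nil => rfl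
  | append_singleton l v ih =>
    rw [List.length_append, List.length_singleton, Function.iterate_succ_apply,
      ← List.cons_append, nest_concat (List.cons_ne_nil u l)]
    simp only [unnestStep, parts_tuple, List.getD_cons_zero, List.getD_cons_succ]
    rw [ih, List.append_assoc, List.singleton_append]

theorem unnest_nest {n : ℕ} {l : List (Word k)} (hl : l.length = n + 1) :
    unnest n (nest l) = l := by
  obtain ⟨u, l, rfl⟩ := List.exists_cons_of_length_eq_add_one hl
  obtain rfl : l.length = n := by simpa using hl
  simp only [unnest, iterate_unnestStep, List.append_nil]

theorem primrec_nest : Primrec (nest : List (Word k) → Word k) := by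
  have pair : Primrec₂ fun (_ : List (Word k) × Word k × List (Word k)) (x : Word k × Word k) =>
      tuple [x.1, x.2] :=
    primrec_tuple.comp (list_cons.comp (Primrec.fst.comp .snd)
      (list_cons.comp (Primrec.snd.comp .snd) (.const [])))
  have fold : Primrec₂ fun (_ : List (Word k)) (x : Word k × List (Word k)) =>
      x.2.foldl (fun w v => tuple [w, v]) x.1 :=
    list_foldl (Primrec.snd.comp .snd) (Primrec.fst.comp .snd) pair
  exact (list_casesOn .id (.const []) fold).of_eq fun l => by cases l <;> rfl

theorem primrec_unnest : Primrec₂ (unnest : ℕ → Word k → List (Word k)) := by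
  have part : ∀ i, Primrec₂ fun (_ : ℕ × Word k) (x : Word k × List (Word k)) =>
      (parts x.1).getD i [] := fun i =>
    (list_getD []).comp (primrec_parts.comp (Primrec.fst.comp .snd)) (.const i)
  have step : Primrec₂ fun (_ : ℕ × Word k) (x : Word k × List (Word k)) => unnestStep x :=
    Primrec.pair (part 0) (list_cons.comp (part 1) (Primrec.snd.comp .snd))
  have iterated : Primrec fun x : ℕ × Word k => unnestStep^[x.1] (x.2, []) :=
    nat_iterate .fst (Primrec.pair .snd (.const [])) step
  exact list_cons.comp (Primrec.fst.comp iterated) (Primrec.snd.comp iterated)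

/-- The boxes of a product of `n + 1` factors that is bracketed to the left. -/
def finBoxes (k n : ℕ) : BoxCoding k where
  Index := Fin (n + 1)
  index := Fin.valEmbedding
  arity m := m = n + 1
  code := nest
  sides := unnest n
  mem_range_index hm hj := ⟨⟨_, hm ▸ hj⟩, rfl⟩
  sides_code := unnest_nest

theorem isPrimrec_finBoxes : BoxCoding.IsPrimrec (finBoxes k) where
  range := (nat_lt.comp .snd (succ.comp .fst)).of_eq fun x =>
    ⟨fun h => ⟨⟨x.2, h⟩, rfl⟩, by rintro ⟨i, hi⟩; exact hi ▸ i.2⟩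
  arity := Primrec.eq.comp .snd (succ.comp .fst)
  code := primrec_nest.comp .snd
  sides := primrec_unnest

theorem exists_ofFn_eq {α : Type*} {n : ℕ} {l : List α} (hl : l.length = n) :
    ∃ u : Fin n → α, List.ofFn u = l := by
  subst hl
  exact ⟨l.get, List.ofFn_get l⟩

theorem forall_mem_getElem?_ofFn {α : Type*} {n : ℕ} {u : Fin n → α} {i : Fin n} {P : α → Prop} :
    (∀ v ∈ (List.ofFn u)[(i : ℕ)]?, P v) ↔ P (u i) := by
  simp

theorem nest_ofFn_succ {n : ℕ} (u : Fin (n + 2) → Word k) :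
    nest (List.ofFn u) = tuple [nest (List.ofFn fun i => u i.castSucc), u (Fin.last _)] := by
  rw [List.ofFn_succ', List.concat_eq_append, nest_concat (by simp)]

namespace CompactPair

/-- The point of a product bracketed to the left with the coordinates `x i`. -/
def finPoint : (n : ℕ) → (A : Fin (n + 1) → CompactPair.{u} k) →
    (∀ i, (A i).space) → (finProd n A).space
  | 0, _, x => x 0
  | n + 1, A, x => (finPoint n (fun i => A i.castSucc) fun i => x i.castSucc, x (Fin.last _))

theorem surjective_finPoint (n : ℕ) (A : Fin (n + 1) → CompactPair.{u} k) :
    Function.Surjective (finPoint n A) := by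
  induction n with
  | zero => exact fun z => ⟨fun i => Fin.cases z (fun j => j.elim0) i, rfl⟩
  | succ n ih =>
    rintro ⟨z, y⟩
    obtain ⟨x, rfl⟩ := ih _ z
    refine ⟨Fin.snoc (α := fun i => (A i).space) x y, ?_⟩
    simp only [finPoint, Fin.snoc_castSucc, Fin.snoc_last]
    rfl

theorem mem_finProd_dom_iff {n : ℕ} {A : Fin (n + 1) → CompactPair.{u} k} {w : Word k} :
    w ∈ (finProd n A).space.dom ↔
      ∃ u : Fin (n + 1) → Word k, (∀ i, u i ∈ (A i).space.dom) ∧ nest (List.ofFn u) = w := by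
  induction n generalizing w with
  | zero =>
    constructor
    · exact fun hw => ⟨fun _ => w, Fin.forall_fin_one.2 hw, rfl⟩
    · rintro ⟨u, hu, rfl⟩
      exact hu 0
  | succ n ih =>
    constructor
    · rintro ⟨w, hw, v, hv, rfl⟩
      obtain ⟨u, hu, rfl⟩ := ih.1 hw
      refine ⟨Fin.snoc (α := fun _ => Word k) u v, Fin.forall_fin_succ'.2 ⟨?_, ?_⟩, ?_⟩
      · simpa only [Fin.snoc_castSucc] using hu
      · simpa only [Fin.snoc_last] using hv
      · simp only [nest_ofFn_succ, Fin.snoc_castSucc, Fin.snoc_last]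
    · rintro ⟨u, hu, rfl⟩
      exact ⟨_, ih.2 ⟨_, fun i => hu i.castSucc, rfl⟩, _, hu (Fin.last _), nest_ofFn_succ u⟩

theorem finPoint_mem_nu_iff {n : ℕ} {A : Fin (n + 1) → CompactPair.{u} k}
    {x : ∀ i, (A i).space} {u : Fin (n + 1) → Word k} :
    finPoint n A x ∈ (finProd n A).space.nu (nest (List.ofFn u)) ↔
      ∀ i, x i ∈ (A i).space.nu (u i) := by
  induction n with
  | zero =>
    rw [Fin.forall_fin_one]
    exact Iff.rfl
  | succ n ih =>
    rw [Fin.forall_fin_succ', ← ih, nest_ofFn_succ]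
    exact Set.ext_iff.1 (EffSpace.prodNu_tuple _ _ _ _) _

theorem finPoint_mem_set_iff {n : ℕ} {A : Fin (n + 1) → CompactPair.{u} k}
    {x : ∀ i, (A i).space} :
    finPoint n A x ∈ (finProd n A).set ↔ ∀ i, x i ∈ (A i).set := by
  induction n with
  | zero =>
    rw [Fin.forall_fin_one]
    exact Iff.rfl
  | succ n ih =>
    rw [Fin.forall_fin_succ', ← ih]
    exact Iff.rfl

/-- The product of `n + 1` pairs as a presented product. -/
def finPresentation {n : ℕ} (A : Fin (n + 1) → CompactPair.{u} k) :
    (finBoxes k n).Presentation A (finProd n A) where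
  point := finPoint n A
  surjective_point := surjective_finPoint n A
  mem_dom_iff := by
    intro w
    rw [mem_finProd_dom_iff]
    constructor
    · rintro ⟨u, hu, rfl⟩
      exact ⟨_, List.length_ofFn, fun i => forall_mem_getElem?_ofFn.2 (hu i), rfl⟩
    · rintro ⟨l, hl, hmem, rfl⟩
      obtain ⟨u, rfl⟩ := exists_ofFn_eq hl
      exact ⟨u, fun i => forall_mem_getElem?_ofFn.1 (hmem i), rfl⟩
  point_mem_nu_code_iff := by
    intro x l hl
    obtain ⟨u, rfl⟩ := exists_ofFn_eq hl
    exact finPoint_mem_nu_iff.trans (forall_congr' fun i =>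
      (forall_mem_getElem?_ofFn (P := fun v => x i ∈ (A i).space.nu v)).symm)
  point_mem_set_iff := finPoint_mem_set_iff

end CompactPair

/-! ### Countable products -/

/-- The boxes of a countable product. -/
def piBoxes (k : ℕ) : BoxCoding k where
  Index := ℕ
  index := .refl ℕ
  arity m := 0 < m
  code := tuple
  sides := parts
  mem_range_index := fun _ _ => ⟨_, rfl⟩
  sides_code := fun _ => parts_tuple _

theorem isPrimrec_piBoxes : BoxCoding.IsPrimrec fun _ => piBoxes k where
  range := (Primrec.eq.comp .id .id).of_eq fun x => iff_of_true rfl ⟨x.2, rfl⟩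
  arity := nat_lt.comp (.const 0) .snd
  code := primrec_tuple.comp .snd
  sides := primrec_parts.comp .snd

theorem forall_mem_getElem?_iff {α : Type*} {l : List α} {i : ℕ} {P : α → Prop} :
    (∀ v ∈ l[i]?, P v) ↔ ∀ h : i < l.length, P l[i] := by
  simp [List.getElem?_eq_some_iff]

/-- The product of a sequence of pairs as a presented product. -/
def CompactPair.piPresentation (A : ℕ → CompactPair.{u} k) :
    (piBoxes k).Presentation A (CompactPair.pi A) where
  point := id
  surjective_point := Function.surjective_id
  mem_dom_iff := by
    intro w
    constructor
    · rintro ⟨l, hl, rfl, hmem⟩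
      exact ⟨l, List.length_pos_iff.2 hl, fun i => forall_mem_getElem?_iff.2 (hmem i), rfl⟩
    · rintro ⟨l, hl, hmem, rfl⟩
      exact ⟨l, List.length_pos_iff.1 hl, rfl, fun i => forall_mem_getElem?_iff.1 (hmem i)⟩
  point_mem_nu_code_iff := by
    intro x l hl
    refine (Set.ext_iff.1 (EffSpace.piNu_tuple _ (List.length_pos_iff.1 hl)) x).trans ?_
    exact forall_congr' fun i =>
      (forall_mem_getElem?_iff (P := fun v => x i ∈ (A i).space.nu v)).symm
  point_mem_set_iff := Set.mem_univ_pi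

/-! ### The Tychonoff theorem -/

theorem repComputable_prod (k : ℕ) :
    RepComputable (kappaDelta.pair kappaDelta) kappaDelta
      (fun A : CompactPair.{u} k × CompactPair.{u} k => A.1.prod A.2) := by
  have hpos : Primrec₂ fun (a : ℕ × ℕ) (j : ℕ) => 2 * j + a.2 :=
    nat_add.comp (nat_double.comp .snd) (Primrec.snd.comp .fst)
  refine isPrimrec_finBoxes.repComputable (format := fun _ m => m = 1)
    (.of_primrec (Primrec.eq.comp .id (.const 1))) hpos ?_
  rintro _ ⟨A₁, A₂⟩ ⟨p₁, p₂, rfl, h₁, h₂⟩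
  refine ⟨1, fun _ => Iff.rfl, ![A₁, A₂], Fin.forall_fin_two.2 ⟨?_, ?_⟩,
    ⟨CompactPair.finPresentation ![A₁, A₂]⟩⟩
  · exact (congrArg (kappaDelta · A₁) (evens_seqPair p₁ p₂)).mpr h₁
  · exact (congrArg (kappaDelta · A₂) (odds_seqPair p₁ p₂)).mpr h₂

theorem tag_of_lt {n m : ℕ} (p : Seq k) (h : m < n) : tag n p m = 1 :=
  if_pos h

theorem tag_self (n : ℕ) (p : Seq k) : tag n p n = 0 := by
  simp [tag]

theorem tag_add (n m : ℕ) (p : Seq k) : tag n p (n + 1 + m) = p m := by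
  rw [tag, if_neg (by omega), if_neg (by omega), Nat.add_sub_cancel_left]

theorem tag_eq_one_and_eq_zero_iff {n m : ℕ} {p : Seq k} :
    ((∀ i ∈ List.range m, tag n p i = 1) ∧ tag n p m = 0) ↔ m = n := by
  constructor
  · rintro ⟨ones, zero⟩
    rcases lt_trichotomy m n with h | h | h
    · exact absurd ((tag_of_lt p h).symm.trans zero) one_ne_zero
    · exact h
    · exact absurd ((ones n (List.mem_range.2 h)).symm.trans (tag_self n p)) one_ne_zero
  · rintro rfl
    exact ⟨fun i hi => tag_of_lt p (List.mem_range.1 hi), tag_self m p⟩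

theorem primrec_cantorPair : Primrec₂ cantorPair := by
  have hadd : Primrec₂ fun i j : ℕ => i + j := nat_add
  exact nat_add.comp (nat_div.comp (nat_mul.comp hadd (succ.comp hadd)) (.const 2)) .snd

theorem repComputable_finProd (k : ℕ) :
    RepComputable kappaDelta.plus kappaDelta
      (fun A : Σ n : ℕ, (Fin (n + 1) → CompactPair.{u} k) => CompactPair.finProd A.1 A.2) := by
  have hpos : Primrec₂ fun (a : ℕ × ℕ) (j : ℕ) => a.1 + 2 + (j * (a.1 + 1) + a.2) :=
    nat_add.comp (nat_add.comp (Primrec.fst.comp .fst) (.const 2)) (nat_add.comp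
      (nat_mul.comp .snd (succ.comp (Primrec.fst.comp .fst))) (Primrec.snd.comp .fst))
  have hformat : SemiDec fun (p : Seq k) n => (∀ m ∈ List.range (n + 1), p m = 1) ∧ p (n + 1) = 0 :=
    (SemiDec.forall_mem (φ := fun p _ m => p m = 1) (list_range.comp succ)
      (.symbol_eq .snd (.const 1))).and (.symbol_eq succ (.const 0))
  refine isPrimrec_finBoxes.repComputable hformat hpos ?_
  rintro _ ⟨n, A⟩ ⟨p, rfl, hp⟩
  refine ⟨n, fun m => ?_, A, fun i : Fin (n + 1) => ?_, ⟨CompactPair.finPresentation A⟩⟩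
  · exact tag_eq_one_and_eq_zero_iff.trans Nat.add_right_cancel_iff
  · have factor : (fun j => tag (n + 1) (seqTuple p) (n + 2 + (j * (n + 1) + i))) = p i :=
      funext fun j => (tag_add _ _ _).trans (seqTuple_apply p i j)
    exact (congrArg (kappaDelta · (A i)) factor).mpr (hp i)

theorem repComputable_pi (k : ℕ) :
    RepComputable kappaDelta.seq kappaDelta
      (fun A : ℕ → CompactPair.{u} k => CompactPair.pi A) := by
  have hpos : Primrec₂ fun (a : ℕ × ℕ) (j : ℕ) => cantorPair a.2 j :=
    primrec_cantorPair.comp (Primrec.snd.comp .fst) .snd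
  refine isPrimrec_piBoxes.repComputable (format := fun _ m => m = 0)
    (.of_primrec (Primrec.eq.comp .id (.const 0))) hpos ?_
  rintro q A ⟨p, hq, hp⟩
  refine ⟨0, fun _ => Iff.rfl, A, fun i => ?_, ⟨CompactPair.piPresentation A⟩⟩
  exact (congrArg (kappaDelta · (A i)) (funext (hq i))).mpr (hp i)

end TTE

theorem theorem6 (k : ℕ) :
    TTE.RepComputable (TTE.kappaDelta.pair TTE.kappaDelta) TTE.kappaDelta
      (fun A : TTE.CompactPair.{u} k × TTE.CompactPair.{u} k => A.1.prod A.2) ∧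
    TTE.RepComputable TTE.kappaDelta.plus TTE.kappaDelta
      (fun A : Σ n : ℕ, (Fin (n + 1) → TTE.CompactPair.{u} k) =>
        TTE.CompactPair.finProd A.1 A.2) ∧
    TTE.RepComputable TTE.kappaDelta.seq TTE.kappaDelta
      (fun A : ℕ → TTE.CompactPair.{u} k => TTE.CompactPair.pi A) :=
  ⟨TTE.repComputable_prod k, TTE.repComputable_finProd k, TTE.repComputable_pi k⟩
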